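/- Let $S$ be a countable index set. For $r\in(0,\infty)$ let $\Phi_r(x)=\exp(-x^{-r})$, $x>0$, be the $r$-Fréchet distribution function, and let $\Phi_\infty$ be the distribution function of the unit mass at $1$. A simple max-stable process on $S$ is a max-stable real-valued process with $\Phi_1$ margins. For $p\in(1,\infty]$, a process $X=\{X(s)\}_{s\in S}$ is said to have an $\ell^p$ representation with spectral process $W^{(p)}$ if $W^{(p)}$ is a nonnegative process with $\mathbb E\,W^{(p)}(s)=1$ for all $s\in S$ and, in distribution as processes on $S$, $$X(\cdot)=_d\frac{U^{(p)}(\cdot)}{\Gamma(1-p^{-1})}\,\big\|\big(A_iW^{(p)}_i(\cdot)\big)_{i\in\mathbb N}\big\|_p ,$$ where $\|\cdot\|_p$ is the $\ell^p$ norm, $\{U^{(p)}(s)\}_{s\in S}$ are independent $\Phi_p$ random variables, $\sum_i\delta_{A_i}$ is a Poisson point process on $(0,\infty)$ with intensity $a^{-2}\,da$, $W^{(p)}_i$, $i\in\mathbb N$, are independent copies of $W^{(p)}$, and the three families are independent of each other. $X$ has a de Haan spectral representation with spectral process $V$ if $V$ is a nonnegative process with $\mathbb E\,V(s)=1$ for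 all $s$ and $X(\cdot)=_d\max_{i\in\mathbb N}A_iV_i(\cdot)$, with $(A_i)$ as above and, independently of it, independent copies $V_i$ of $V$. Let $\mathcal{MS}_p$ be the class of simple max-stable processes on $S$ that have an $\ell^p$ representation. Let $p\in(1,\infty)$ and let $X$ have an $\ell^p$ representation with spectral process $W^{(p)}$. 1. $X$ has a de Haan spectral representation with spectral process $$V(s)=\frac{U^{(p)}(s)}{\Gamma(1-p^{-1})}\,W^{(p)}(s),\qquad s\in S,$$ where $\{U^{(p)}(s)\}_{s\in S}$ are independent $\Phi_p$ random variables, independent of $W^{(p)}$. 2. For every $q\in(p,\infty)$, $X$ has an $\ell^q$ representation with spectral process $$W^{(q)}(s)=\frac{\Gamma(1-q^{-1})}{\Gamma(1-p^{-1})}\,T(s)^{1/q}\,W^{(p)}(s),\qquad s\in S,$$ where $\{T(s)\}_{s\in S}$, independent of $W^{(p)}$, are independent positive stable random variables with Laplace transform $\mathbb E\,e^{-tT(s)}=e^{-t^{p/q}}$, $t\ge 0$. Consequently $\mathcal{MS}_p\subseteq\mathcal{MS}_q\subseteq\mathcal{MS}_\infty$ for $1<p<q<\infty$. -/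

import Mathlib

open MeasureTheory ProbabilityTheory
open scoped ENNReal NNReal

universe u v w z

noncomputable section

namespace MaxStable

/-- The random path `ω ↦ (s ↦ X s ω)` of a stochastic process. -/
def path {S : Type u} {Ω : Type v} {R : Type*} (X : S → Ω → R) : Ω → S → R :=
  fun ω s => X s ω

/-- The distribution function of the Fréchet law `Φ_p`, `p ∈ (0, ∞]`: `exp (-x ^ (-p))` on
`(0, ∞)` for finite `p`, and its weak limit, the unit mass at `1`, for `p = ∞`. -/
def frechetCDF (p : ℝ≥0∞) (x : ℝ) : ℝ :=
  if p = ∞ then (if 1 ≤ x then 1 else 0)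
  else (if 0 < x then Real.exp (-x ^ (-p.toReal)) else 0)

/-- The random variable `Y` has law `Φ_p`. -/
structure IsFrechet {Ω : Type v} [MeasurableSpace Ω] (p : ℝ≥0∞) (Y : Ω → ℝ) (P : Measure Ω) :
    Prop where
  measurable : Measurable Y
  cdf_eq : ∀ x : ℝ, P {ω | Y ω ≤ x} = ENNReal.ofReal (frechetCDF p x)

/-- `{U s}` is a collection of independent `Φ_p` random variables. -/
structure IsFrechetNoise {S : Type u} {Ω : Type v} [MeasurableSpace Ω] (p : ℝ≥0∞)
    (U : S → Ω → ℝ) (P : Measure Ω) : Prop where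
  frechet : ∀ s, IsFrechet p (U s) P
  indep : iIndepFun U P

/-- `{T s}` is a collection of independent nonnegative random variables with Laplace transform
`exp (-t ^ α)`, i.e. independent standard positive `α`-stable random variables. -/
structure IsStableNoise {S : Type u} {Ω : Type v} [MeasurableSpace Ω] (α : ℝ)
    (T : S → Ω → ℝ) (P : Measure Ω) : Prop where
  measurable : ∀ s, Measurable (T s)
  nonneg : ∀ s, ∀ᵐ ω ∂P, 0 ≤ T s ω
  laplace : ∀ s, ∀ t : ℝ, 0 ≤ t → ∫ ω, Real.exp (-(t * T s ω)) ∂P = Real.exp (-t ^ α)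
  indep : iIndepFun T P

/-- The point process `∑ᵢ δ_{A i}`, a random measure on the line. -/
def pointProcess {Ω : Type v} (A : ℕ → Ω → ℝ) (ω : Ω) : Measure ℝ :=
  Measure.sum fun i => Measure.dirac (A i ω)

/-- The measure `a⁻² da` on `(0, ∞)`. -/
def intensity : Measure ℝ :=
  (volume.restrict (Set.Ioi (0 : ℝ))).withDensity fun a => ENNReal.ofReal ((a ^ 2)⁻¹)

/-- `∑ᵢ δ_{A i}` is a Poisson point process on `(0, ∞)` with intensity measure `a⁻² da`. -/
structure IsPoissonProcess {Ω : Type v} [MeasurableSpace Ω] (A : ℕ → Ω → ℝ) (P : Measure Ω) :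
    Prop where
  measurable : ∀ i, Measurable (A i)
  pos : ∀ᵐ ω ∂P, ∀ i, 0 < A i ω
  /-- The number of points in a set of finite intensity is Poisson distributed. -/
  poisson : ∀ B : Set ℝ, MeasurableSet B → intensity B ≠ ∞ → ∀ n : ℕ,
    P {ω | pointProcess A ω B = n} = poissonMeasure (intensity B).toNNReal {n}
  /-- The numbers of points in disjoint sets are independent. -/
  indep : ∀ (n : ℕ) (B : Fin n → Set ℝ), (∀ j, MeasurableSet (B j)) →
    Pairwise (Function.onFun Disjoint B) →
    iIndepFun (fun j ω => pointProcess A ω (B j)) P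

/-- A process that may serve as a spectral process: nonnegative with `E (W s) = 1`.
(The Bochner integral being `1` includes integrability.) -/
structure IsSpectralProcess {S : Type u} {Ω : Type v} [MeasurableSpace Ω]
    (W : S → Ω → ℝ) (P : Measure Ω) : Prop where
  measurable : ∀ s, Measurable (W s)
  nonneg : ∀ s, ∀ᵐ ω ∂P, 0 ≤ W s ω
  mean_one : ∀ s, ∫ ω, W s ω ∂P = 1

/-- The processes `W₀, W₁, …` are independent copies of the process `V`. -/
structure IsIndepCopies {S : Type u} {Ω : Type v} {E : Type w} [MeasurableSpace Ω]
    [MeasurableSpace E] (W : ℕ → S → Ω → ℝ) (P : Measure Ω) (V : S → E → ℝ) (Q : Measure E) :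
    Prop where
  measurable : ∀ i s, Measurable (W i s)
  copy : ∀ i, IdentDistrib (path (W i)) (path V) P Q
  indep : iIndepFun (fun i => path (W i)) P

/-- The `ℓ^p` norm, `p ∈ (1, ∞]`, of a nonnegative sequence, with value `∞` if the sequence is
not in `ℓ^p`. -/
def seqNorm (p : ℝ≥0∞) (x : ℕ → ℝ) : ℝ≥0∞ :=
  if p = ∞ then ⨆ i, ENNReal.ofReal (x i)
  else (∑' i, ENNReal.ofReal (x i) ^ p.toReal) ^ (1 / p.toReal)

/-- The constant `Γ(1 - 1/p)`; since `∞.toReal = 0` and `1 / 0 = 0`, it is `Γ(1) = 1`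
for `p = ∞`. -/
def gammaConst (p : ℝ≥0∞) : ℝ := Real.Gamma (1 - 1 / p.toReal)

/-- The de Haan spectral representation: in law, `X(s) = maxᵢ Aᵢ Vᵢ(s)`, where `∑ᵢ δ_{Aᵢ}` is a
Poisson process with intensity `a⁻² da` and, independently, the `Vᵢ` are independent copies of the
spectral process `V`.  Both sides are compared as extended-real-valued processes, so that
finiteness of the maximum is part of the claim. -/
def HasDeHaanRepresentation {S : Type u} {Ω : Type v} {E : Type w} [MeasurableSpace Ω]
    [MeasurableSpace E] (X : S → Ω → ℝ) (P : Measure Ω) (V : S → E → ℝ) (Q : Measure E) : Prop :=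
  IsSpectralProcess V Q ∧
  ∃ (Ω' : Type u) (_ : MeasurableSpace Ω') (P' : Measure Ω') (A : ℕ → Ω' → ℝ)
    (V' : ℕ → S → Ω' → ℝ),
    IsProbabilityMeasure P' ∧
    IsPoissonProcess A P' ∧
    IsIndepCopies V' P' V Q ∧
    IndepFun (path A) (fun ω i s => V' i s ω) P' ∧
    IdentDistrib (fun ω s => (X s ω : EReal))
      (fun ω s => ((⨆ i, ENNReal.ofReal (A i ω * V' i s ω) : ℝ≥0∞) : EReal)) P P'

/-- The `ℓ^p` norm based representation: in law,
`X(s) = U(s) / Γ(1 - 1/p) * ‖(Aᵢ Wᵢ(s))ᵢ‖_p`, where the `U(s)` are independent `Φ_p` variables,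
`∑ᵢ δ_{Aᵢ}` is a Poisson process with intensity `a⁻² da`, the `Wᵢ` are independent copies of the
spectral process `W`, and the three families are independent. -/
def HasLpRepresentation {S : Type u} {Ω : Type v} {E : Type w} [MeasurableSpace Ω]
    [MeasurableSpace E] (p : ℝ≥0∞) (X : S → Ω → ℝ) (P : Measure Ω) (W : S → E → ℝ)
    (Q : Measure E) : Prop :=
  IsSpectralProcess W Q ∧
  ∃ (Ω' : Type u) (_ : MeasurableSpace Ω') (P' : Measure Ω') (U : S → Ω' → ℝ) (A : ℕ → Ω' → ℝ)
    (W' : ℕ → S → Ω' → ℝ),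
    IsProbabilityMeasure P' ∧
    IsFrechetNoise p U P' ∧
    IsPoissonProcess A P' ∧
    IsIndepCopies W' P' W Q ∧
    IndepFun (path A) (fun ω i s => W' i s ω) P' ∧
    IndepFun (path U) (fun ω => (path A ω, fun (i : ℕ) (s : S) => W' i s ω)) P' ∧
    IdentDistrib (fun ω s => (X s ω : EReal))
      (fun ω s => ((ENNReal.ofReal (U s ω / gammaConst p) *
        seqNorm p (fun i => A i ω * W' i s ω) : ℝ≥0∞) : EReal)) P P'

/-- `W'` is a copy of the process `W` that is independent of the process `Z`. -/
structure IsIndepCopy {S : Type u} {E : Type w} {E' : Type v} [MeasurableSpace E]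
    [MeasurableSpace E'] (Z W' : S → E' → ℝ) (R : Measure E') (W : S → E → ℝ) (Q : Measure E) :
    Prop where
  measurable : ∀ s, Measurable (W' s)
  copy : IdentDistrib (path W') (path W) R Q
  indep : IndepFun (path Z) (path W') R

/-- Max-stability: for each `n ≥ 1` there are norming functions `a > 0` and `b` such that `X` has
the law of `max_{i ≤ n} (Xᵢ - b) / a` for independent copies `X₁, …, Xₙ` of `X` (realised on the
`n`-fold product space). -/
def IsMaxStable {S : Type u} {Ω : Type v} [MeasurableSpace Ω] (X : S → Ω → ℝ) (P : Measure Ω) :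
    Prop :=
  ∀ n : ℕ, 1 ≤ n → ∃ a b : S → ℝ, (∀ s, 0 < a s) ∧
    IdentDistrib (path X) (fun (ω : Fin n → Ω) s => ⨆ i, (X s (ω i) - b s) / a s)
      P (Measure.pi fun _ => P)

/-- A simple max-stable process: max-stable with unit Fréchet margins. -/
def IsSimpleMaxStable {S : Type u} {Ω : Type v} [MeasurableSpace Ω] (X : S → Ω → ℝ)
    (P : Measure Ω) : Prop :=
  IsMaxStable X P ∧ ∀ s, IsFrechet 1 (X s) P

/-- The class `MS_p`, `p ∈ (1, ∞]`, of simple max-stable processes (on a given probability space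
and with a given index set) that admit an `ℓ^p` norm based representation. -/
def MS (S : Type u) {Ω : Type v} [MeasurableSpace Ω] (P : Measure Ω) (p : ℝ≥0∞) :
    Set (S → Ω → ℝ) :=
  {X | IsSimpleMaxStable X P ∧
    ∃ (E : Type u) (_ : MeasurableSpace E) (Q : Measure E) (W : S → E → ℝ),
      IsProbabilityMeasure Q ∧ HasLpRepresentation p X P W Q}

end MaxStable

end

open MaxStable

/-!
An `ℓ^p` representation, the associated de Haan representation and the associated `ℓ^q`
representation are built on the same Poisson points `(Aᵢ)`, and they already agree in law
conditionally on these points.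

The law of a `[0, ∞]`-valued process is determined by its finite-dimensional distribution functions
(`map_eq_of_measure_le`). Integrating out first the independent noise and then the independent
marks attached to the points turns each of these functions at `x` into `E ∏ᵢ g(Aᵢ)`, where `g(a)` is
the contribution of one point at height `a` (`lintegral_expNeg_tsum`,
`measure_lpRepresentation_le`, `measure_deHaanRepresentation_le`). All three representations have
the same factor
`g(a) = E exp (-∑ₛ (a W(s) / (Γ(1 - 1/p) x(s))) ^ p)`:
for the de Haan representation because `P(U(s) ≤ y) = exp (-y ^ (-p))` (`measure_frechet_mul_le`),
and for the `ℓ^q` representation because `E exp (-c T(s)) = exp (-c ^ (p/q))`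
(`lintegral_stable_lpExponent`). Hence nothing about the law of `(Aᵢ)` is needed here beyond its
being the same in both representations.

The new spectral processes have mean one because `E U = Γ(1 - 1/p)` for `U` with law `Φ_p`, and
because `U T ^ (1/q)` has law `Φ_p` when `U` has law `Φ_q`, so that
`E T ^ (1/q) = Γ(1 - 1/p) / Γ(1 - 1/q)` (`IsStableNoise.lintegral_rpow`).

Only the existence of the positive stable noise uses that `(Aᵢ)` is Poisson: by the formula for
the Laplace functional (`IsPoissonProcess.lintegral_expNeg_tsum`), a suitable multiple of
`∑ᵢ Aᵢ ^ (1/α)` is positive `α`-stable (`IsPoissonProcess.exists_stable`).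

The inclusion of the finite classes in `MS_∞` follows since a de Haan representation is an `ℓ^∞`
representation with the constant noise `1`.
-/

namespace MaxStable

open Filter Topology

/-! ### The function `exp (-z)` on `[0, ∞]` -/

/-- The function `z ↦ exp (-z)` on `[0, ∞]`, with `exp (-∞) = 0`. -/
noncomputable def expNeg (z : ℝ≥0∞) : ℝ≥0∞ := EReal.exp (-(z : EReal))

@[simp] lemma expNeg_zero : expNeg 0 = 1 := by simp [expNeg]

@[simp] lemma expNeg_top : expNeg ∞ = 0 := by simp [expNeg]

lemma expNeg_ofReal {x : ℝ} (hx : 0 ≤ x) :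
    expNeg (ENNReal.ofReal x) = ENNReal.ofReal (Real.exp (-x)) := by
  rw [expNeg, EReal.coe_ennreal_ofReal, max_eq_left hx, ← EReal.coe_neg, EReal.exp_coe]

lemma expNeg_add (a b : ℝ≥0∞) : expNeg (a + b) = expNeg a * expNeg b := by
  have h (c : ℝ≥0∞) : EReal.exp (c : EReal) ≠ 0 := by
    simp only [ne_eq, EReal.exp_eq_zero_iff]
    exact (bot_lt_iff_ne_bot.1 (lt_of_lt_of_le EReal.bot_lt_zero (EReal.coe_ennreal_nonneg c)))
  simp only [expNeg, EReal.exp_neg, EReal.coe_ennreal_add, EReal.exp_add]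
  exact ENNReal.mul_inv (Or.inl (h a)) (Or.inr (h b))

lemma expNeg_sum {ι : Type*} (s : Finset ι) (f : ι → ℝ≥0∞) :
    expNeg (∑ i ∈ s, f i) = ∏ i ∈ s, expNeg (f i) := by
  classical
  induction s using Finset.induction_on with
  | empty => simp
  | insert a s ha ih => rw [Finset.sum_insert ha, Finset.prod_insert ha, expNeg_add, ih]

lemma continuous_expNeg : Continuous expNeg :=
  EReal.expHomeomorph.continuous.comp (continuous_neg.comp continuous_coe_ennreal_ereal)

@[fun_prop]
lemma measurable_expNeg : Measurable expNeg := continuous_expNeg.measurable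

lemma expNeg_antitone : Antitone expNeg := fun a b h => by
  simpa [expNeg] using h

lemma expNeg_le_one (z : ℝ≥0∞) : expNeg z ≤ 1 := by
  simpa using expNeg_antitone (zero_le (a := z))

lemma expNeg_tsum (f : ℕ → ℝ≥0∞) :
    expNeg (∑' i, f i) = ⨅ n, ∏ i ∈ Finset.range n, expNeg (f i) := by
  have h1 : Tendsto (fun n => expNeg (∑ i ∈ Finset.range n, f i)) atTop
      (𝓝 (expNeg (∑' i, f i))) :=
    (continuous_expNeg.tendsto _).comp ENNReal.summable.hasSum.tendsto_sum_nat
  have h2 : Antitone (fun n => expNeg (∑ i ∈ Finset.range n, f i)) := fun m n h =>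
    expNeg_antitone (Finset.sum_le_sum_of_subset (Finset.range_mono h))
  rw [tendsto_nhds_unique h1 (tendsto_atTop_iInf h2)]
  simp only [expNeg_sum]

/-! ### Fréchet laws -/

/-- The Fréchet law `Φ_r` as the law of `E ^ (-1/r)`, with `E` a standard exponential variable. -/
noncomputable def frechetMeasure (r : ℝ) : Measure ℝ :=
  (expMeasure 1).map fun x => x ^ (-(1 / r))

instance (r : ℝ) : IsProbabilityMeasure (frechetMeasure r) :=
  have := isProbabilityMeasure_expMeasure one_pos
  Measure.isProbabilityMeasure_map (by fun_prop)

lemma expMeasure_one_Iic {x : ℝ} (hx : 0 ≤ x) :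
    expMeasure 1 (Set.Iic x) = ENNReal.ofReal (1 - Real.exp (-x)) := by
  have := isProbabilityMeasure_expMeasure one_pos
  rw [← ofReal_cdf, cdf_expMeasure_eq one_pos]
  simp [hx]

lemma ae_pos_expMeasure_one : ∀ᵐ x ∂(expMeasure 1), 0 < x := by
  have := expMeasure_one_Iic le_rfl
  simp only [neg_zero, Real.exp_zero, sub_self, ENNReal.ofReal_zero] at this
  rw [ae_iff]
  simpa [Set.Iic] using this

lemma expMeasure_one_Ici {x : ℝ} (hx : 0 ≤ x) :
    expMeasure 1 (Set.Ici x) = ENNReal.ofReal (Real.exp (-x)) := by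
  have := isProbabilityMeasure_expMeasure one_pos
  have hna : NullSingletonClass (expMeasure 1) := nullSingletonClass_withDensity _
  rw [measure_congr (Ioi_ae_eq_Ici (μ := expMeasure 1) (a := x)).symm, ← Set.compl_Iic,
    prob_compl_eq_one_sub measurableSet_Iic, expMeasure_one_Iic hx, ← ENNReal.ofReal_one,
    ← ENNReal.ofReal_sub _ (by simpa using hx)]
  simp

lemma frechetMeasure_Iic {p : ℝ≥0∞} (hp1 : 1 < p) (hp : p < ∞) (x : ℝ) :
    frechetMeasure p.toReal (Set.Iic x) = ENNReal.ofReal (frechetCDF p x) := by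
  have hr : 0 < p.toReal := ENNReal.toReal_pos (zero_lt_one.trans hp1).ne' hp.ne
  rw [frechetMeasure, Measure.map_apply (by fun_prop) measurableSet_Iic, frechetCDF,
    if_neg hp.ne]
  split_ifs with hx
  · rw [← expMeasure_one_Ici (Real.rpow_nonneg hx.le _)]
    apply measure_congr
    filter_upwards [ae_pos_expMeasure_one] with y hy
    have : (y ^ (-(1 / p.toReal)) ≤ x) = (x ^ (-p.toReal) ≤ y) := by
      rw [← Real.rpow_le_rpow_iff_of_neg hx (Real.rpow_pos_of_pos hy _)
        (neg_lt_zero.2 hr), ← Real.rpow_mul hy.le]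
      have : -(1 / p.toReal) * -p.toReal = 1 := by field_simp
      rw [this, Real.rpow_one]
    exact this
  · rw [ENNReal.ofReal_zero]
    refine measure_mono_null (fun y hy => ?_) (ae_iff.1 ae_pos_expMeasure_one)
    intro hy0
    exact hx ((Real.rpow_pos_of_pos hy0 _).trans_le hy)

lemma lintegral_frechetMeasure {r : ℝ} (hr : 1 < r) :
    ∫⁻ x, ENNReal.ofReal x ∂(frechetMeasure r) = ENNReal.ofReal (Real.Gamma (1 - 1 / r)) := by
  have hr0 : 1 / r < 1 := by rw [div_lt_one (by linarith)]; exact hr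
  rw [frechetMeasure, lintegral_map (by fun_prop) (by fun_prop),
    Real.Gamma_eq_integral (by linarith),
    ofReal_integral_eq_lintegral_ofReal (Real.GammaIntegral_convergent (by linarith)),
    expMeasure, gammaMeasure, lintegral_withDensity_eq_lintegral_mul₀ (f := gammaPDF 1 1)
      (measurable_gammaPDFReal 1 1).ennreal_ofReal.aemeasurable (by fun_prop),
    ← lintegral_indicator measurableSet_Ioi]
  · apply lintegral_congr_ae
    have h0 : ∀ᵐ x : ℝ, x ≠ 0 := by simp [ae_iff]
    filter_upwards [h0] with x hx0
    simp only [Pi.mul_apply, Set.indicator, Set.mem_Ioi]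
    split_ifs with hx
    · rw [gammaPDF_of_nonneg hx.le, ← ENNReal.ofReal_mul (by positivity)]
      simp only [Real.one_rpow, Real.Gamma_one, sub_self, Real.rpow_zero]
      norm_num
    · rw [gammaPDF_of_neg (lt_of_le_of_ne (not_lt.1 hx) hx0), zero_mul]
  · filter_upwards [ae_restrict_mem measurableSet_Ioi] with x hx
    have : 0 < x := hx
    simp only [Pi.zero_apply]
    positivity

lemma gammaConst_pos {p : ℝ≥0∞} (hp1 : 1 < p) : 0 < gammaConst p := by
  unfold gammaConst
  apply Real.Gamma_pos_of_pos
  rcases eq_or_ne p ∞ with rfl | hp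
  · simp
  have : 1 < p.toReal := by simpa using (ENNReal.toReal_lt_toReal ENNReal.one_ne_top hp).2 hp1
  rw [sub_pos, div_lt_one (by linarith)]
  exact this

namespace IsFrechet

variable {Ω : Type v} [MeasurableSpace Ω] {P : Measure Ω} {p : ℝ≥0∞} {Y : Ω → ℝ}

lemma map_eq [IsProbabilityMeasure P] (h : IsFrechet p Y P) (hp1 : 1 < p) (hp : p < ∞) :
    P.map Y = frechetMeasure p.toReal := by
  have := Measure.isProbabilityMeasure_map (μ := P) h.measurable.aemeasurable
  refine Measure.ext_of_Iic _ _ fun x => ?_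
  rw [frechetMeasure_Iic hp1 hp, Measure.map_apply h.measurable measurableSet_Iic]
  exact h.cdf_eq x

lemma ae_pos (h : IsFrechet p Y P) : ∀ᵐ ω ∂P, 0 < Y ω := by
  have h0 := h.cdf_eq 0
  rw [ae_iff]
  simp only [not_lt]
  rw [h0, frechetCDF]
  split_ifs <;> first | linarith | simp

lemma lintegral_ofReal [IsProbabilityMeasure P] (h : IsFrechet p Y P) (hp1 : 1 < p)
    (hp : p < ∞) : ∫⁻ ω, ENNReal.ofReal (Y ω) ∂P = ENNReal.ofReal (gammaConst p) := by
  have hr : 1 < p.toReal := by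
    simpa using (ENNReal.toReal_lt_toReal ENNReal.one_ne_top hp.ne).2 hp1
  rw [gammaConst, ← lintegral_frechetMeasure hr, ← h.map_eq hp1 hp,
    lintegral_map (by fun_prop) h.measurable]

lemma integral_eq [IsProbabilityMeasure P] (h : IsFrechet p Y P) (hp1 : 1 < p)
    (hp : p < ∞) : ∫ ω, Y ω ∂P = gammaConst p := by
  rw [integral_eq_lintegral_of_nonneg_ae (h.ae_pos.mono fun _ => le_of_lt)
    h.measurable.aestronglyMeasurable, h.lintegral_ofReal hp1 hp,
    ENNReal.toReal_ofReal (gammaConst_pos hp1).le]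

/-- The distribution function of `Φ_p`, read off at the scale `z / Γ(1 - 1/p)` for `z ∈ [0, ∞]`. -/
lemma measure_mul_le (h : IsFrechet p Y P) [IsProbabilityMeasure P] (hp1 : 1 < p) (hp : p < ∞)
    (z x : ℝ≥0∞) (hx : x ≠ 0) :
    P {ω | ENNReal.ofReal (Y ω / gammaConst p) * z ≤ x} =
      expNeg ((z / (ENNReal.ofReal (gammaConst p) * x)) ^ p.toReal) := by
  have hr : 0 < p.toReal := ENNReal.toReal_pos (zero_lt_one.trans hp1).ne' hp.ne
  have hc := gammaConst_pos hp1
  have hc' : ENNReal.ofReal (gammaConst p) ≠ 0 := by simpa using hc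
  rcases eq_or_ne x ∞ with rfl | hxt
  · simp [ENNReal.mul_top hc', hr]
  rcases eq_or_ne z 0 with rfl | hz
  · simp [hr]
  rcases eq_or_ne z ∞ with rfl | hzt
  · rw [ENNReal.top_div_of_ne_top (ENNReal.mul_ne_top ENNReal.ofReal_ne_top hxt),
      ENNReal.top_rpow_of_pos hr, expNeg_top]
    refine measure_mono_null (fun ω hω => ?_) (ae_iff.1 h.ae_pos)
    intro hY
    have : ENNReal.ofReal (Y ω / gammaConst p) ≠ 0 := by simpa using div_pos hY hc
    rw [Set.mem_ofPred_eq, ENNReal.mul_top this] at hω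
    exact hxt (top_le_iff.1 hω)
  lift x to ℝ≥0 using hxt
  lift z to ℝ≥0 using hzt
  have hx0 : 0 < (x : ℝ) := by
    have : x ≠ 0 := by simpa using hx
    positivity
  have hz0 : 0 < (z : ℝ) := by
    have : z ≠ 0 := by simpa using hz
    positivity
  have hset : {ω | ENNReal.ofReal (Y ω / gammaConst p) * z ≤ x} =
      {ω | Y ω ≤ x * gammaConst p / z} := by
    ext ω
    simp only [Set.mem_ofPred_eq]
    rw [← ENNReal.ofReal_coe_nnreal (p := z), ← ENNReal.ofReal_coe_nnreal (p := x),
      ← ENNReal.ofReal_mul' hz0.le, ENNReal.ofReal_le_ofReal_iff hx0.le, div_mul_eq_mul_div,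
      div_le_iff₀ hc, le_div_iff₀ hz0]
  rw [hset, h.cdf_eq, frechetCDF, if_neg hp.ne, if_pos (by positivity)]
  rw [← ENNReal.ofReal_coe_nnreal (p := z), ← ENNReal.ofReal_coe_nnreal (p := x),
    ← ENNReal.ofReal_mul hc.le, ← ENNReal.ofReal_div_of_pos (by positivity),
    ENNReal.ofReal_rpow_of_nonneg (by positivity) hr.le, expNeg_ofReal (by positivity)]
  rw [Real.rpow_neg (by positivity), ← Real.inv_rpow (by positivity)]
  congr 4
  field_simp

end IsFrechet

/-! ### Integrating out independent families -/

lemma iIndepFun.lintegral_finset_prod {Ω : Type*} [MeasurableSpace Ω] {P : Measure Ω}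
    {ι : Type*} {E : Type*} [MeasurableSpace E]
    {X : ι → Ω → E} (hX : ∀ i, Measurable (X i)) (h : iIndepFun X P) (F : Finset ι)
    {g : ι → E → ℝ≥0∞} (hg : ∀ i, Measurable (g i)) :
    ∫⁻ ω, ∏ i ∈ F, g i (X i ω) ∂P = ∏ i ∈ F, ∫⁻ ω, g i (X i ω) ∂P :=
  lintegral_prod_eq_prod_lintegral_of_indepFun F (fun i ω => g i (X i ω))
    (h.comp g hg) fun i => (hg i).comp (hX i)

section Independence

variable {S : Type u} {Ω : Type v} [MeasurableSpace Ω] {P : Measure Ω} [IsProbabilityMeasure P]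

/-- Fubini's theorem for two independent random elements. -/
lemma lintegral_indepFun {α β : Type*} [MeasurableSpace α] [MeasurableSpace β] {X : Ω → α}
    {Y : Ω → β} (hX : Measurable X) (hY : Measurable Y) (h : IndepFun X Y P)
    {f : α → β → ℝ≥0∞} (hf : Measurable fun z : α × β => f z.1 z.2) :
    ∫⁻ ω, f (X ω) (Y ω) ∂P = ∫⁻ ω, ∫⁻ x, f x (Y ω) ∂(P.map X) ∂P := by
  have := Measure.isProbabilityMeasure_map (μ := P) hX.aemeasurable
  have := Measure.isProbabilityMeasure_map (μ := P) hY.aemeasurable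
  have h1 : ∫⁻ ω, f (X ω) (Y ω) ∂P = ∫⁻ z, f z.1 z.2 ∂(P.map fun ω => (X ω, Y ω)) := by
    rw [lintegral_map hf (hX.prodMk hY)]
  rw [h1, h.map_prod_eq_prod_map_map hX.aemeasurable hY.aemeasurable,
    lintegral_prod_symm' _ hf, lintegral_map (Measurable.lintegral_prod_left' hf) hY]

/-- If the `Wᵢ` are independent with law `μ` and independent of `(Aᵢ)`, then
`E exp (-∑ᵢ φ(Aᵢ, Wᵢ))` depends only on the law of `(Aᵢ)` and on the function
`a ↦ ∫ exp (-φ(a, w)) μ(dw)`. -/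
lemma lintegral_expNeg_tsum {M : Type*} [MeasurableSpace M] {A : ℕ → Ω → ℝ} {W : ℕ → Ω → M}
    (hA : ∀ i, Measurable (A i)) (hW : ∀ i, Measurable (W i)) (hWi : iIndepFun W P)
    {μ : Measure M} [IsProbabilityMeasure μ] (hμ : ∀ i, P.map (W i) = μ)
    (hAW : IndepFun (fun ω i => A i ω) (fun ω i => W i ω) P)
    {φ : ℝ → M → ℝ≥0∞} (hφ : Measurable fun z : ℝ × M => φ z.1 z.2) :
    ∫⁻ ω, expNeg (∑' i, φ (A i ω) (W i ω)) ∂P =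
      ∫⁻ a, ⨅ n, ∏ i ∈ Finset.range n, ∫⁻ w, expNeg (φ (a i) w) ∂μ
        ∂(P.map fun ω i => A i ω) := by
  have hA' : Measurable fun ω i => A i ω := measurable_pi_iff.2 hA
  have hW' : Measurable fun ω i => W i ω := measurable_pi_iff.2 hW
  have hm (i : ℕ) : Measurable fun z : (ℕ → M) × (ℕ → ℝ) => φ (z.2 i) (z.1 i) :=
    hφ.comp (f := fun z : (ℕ → M) × (ℕ → ℝ) => (z.2 i, z.1 i))
      (((measurable_pi_apply i).comp measurable_snd).prodMk
        ((measurable_pi_apply i).comp measurable_fst))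
  have hφ' (a : ℝ) : Measurable (φ a) := hφ.comp measurable_prodMk_left
  rw [lintegral_indepFun hW' hA' hAW.symm (f := fun w a => expNeg (∑' i, φ (a i) (w i)))
    (measurable_expNeg.comp (Measurable.tsum hm))]
  have hlaw : P.map (fun ω i => W i ω) = Measure.infinitePi fun _ : ℕ => μ := by
    rw [hWi.map_fun_eq_infinitePi_map hW]
    simp only [hμ]
  rw [hlaw]
  have key (a : ℕ → ℝ) : ∫⁻ w, expNeg (∑' i, φ (a i) (w i)) ∂(Measure.infinitePi fun _ : ℕ => μ) =
      ⨅ n, ∏ i ∈ Finset.range n, ∫⁻ w, expNeg (φ (a i) w) ∂μ := by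
    simp only [expNeg_tsum]
    have hmeas (n : ℕ) : Measurable fun w : ℕ → M =>
        ∏ i ∈ Finset.range n, expNeg (φ (a i) (w i)) :=
      Finset.measurable_fun_prod _ fun i _ =>
        measurable_expNeg.comp ((hφ' (a i)).comp (measurable_pi_apply i))
    -- The partial products decrease, so the infimum passes through the integral.
    rw [lintegral_iInf hmeas]
    · congr 1
      ext n
      rw [iIndepFun.lintegral_finset_prod (X := fun i (w : ℕ → M) => w i)
        (fun i => measurable_pi_apply i)
        (iIndepFun_infinitePi (P := fun _ : ℕ => μ) (X := fun _ w => w) fun _ => measurable_id)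
        (Finset.range n) (g := fun i w => expNeg (φ (a i) w))
        (fun i => measurable_expNeg.comp (hφ' (a i)))]
      refine Finset.prod_congr rfl fun i _ => ?_
      rw [← lintegral_map (μ := Measure.infinitePi fun _ : ℕ => μ) (g := fun w => w i)
        (f := fun w => expNeg (φ (a i) w)) (measurable_expNeg.comp (hφ' (a i)))
        (measurable_pi_apply i),
        Measure.infinitePi_map_eval (fun _ : ℕ => μ)]
    · intro m n hmn w
      exact Finset.prod_le_prod_of_subset_of_le_one' (Finset.range_mono hmn)
        fun i _ _ => expNeg_le_one _
    · simp
  simp only [key]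
  rw [lintegral_map _ hA']
  have hg : Measurable fun a : ℝ => ∫⁻ w, expNeg (φ a w) ∂μ :=
    Measurable.lintegral_prod_right' (f := fun z : ℝ × M => expNeg (φ z.1 z.2))
      (measurable_expNeg.comp hφ)
  exact Measurable.iInf fun n => Finset.measurable_fun_prod _ fun i _ =>
    hg.comp (measurable_pi_apply i)

/-- Integrating out the Fréchet noise: a vector `(U(s) / Γ(1 - 1/p)) Z(s)` with `U` independent
of `Z` has the joint distribution function `E exp (-∑ₛ (Z(s) / (Γ(1 - 1/p) x(s))) ^ p)`. -/
lemma IsFrechetNoise.measure_mul_le {α : Type*} [MeasurableSpace α] {p : ℝ≥0∞} (hp1 : 1 < p)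
    (hp : p < ∞) {U : S → Ω → ℝ} (hU : IsFrechetNoise p U P) {Y : Ω → α} (hY : Measurable Y)
    (hUY : IndepFun (path U) Y P) {f : α → S → ℝ≥0∞} (hf : ∀ s, Measurable fun y => f y s)
    (F : Finset S) {x : S → ℝ≥0∞} (hx : ∀ s, x s ≠ 0) :
    P {ω | ∀ s ∈ F, ENNReal.ofReal (U s ω / gammaConst p) * f (Y ω) s ≤ x s} =
      ∫⁻ ω, expNeg (∑ s ∈ F, (f (Y ω) s / (ENNReal.ofReal (gammaConst p) * x s)) ^ p.toReal)
        ∂P := by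
  have hUm : Measurable (path U) := measurable_pi_iff.2 fun s => (hU.frechet s).measurable
  let B : Set ((S → ℝ) × α) :=
    ⋂ s ∈ F, {z | ENNReal.ofReal (z.1 s / gammaConst p) * f z.2 s ≤ x s}
  have hB : MeasurableSet B := by
    refine Finset.measurableSet_biInter _ fun s _ => measurableSet_le ?_ measurable_const
    exact ((((measurable_pi_apply s).comp measurable_fst).div_const _).ennreal_ofReal).mul
      ((hf s).comp measurable_snd)
  have hset : {ω | ∀ s ∈ F, ENNReal.ofReal (U s ω / gammaConst p) * f (Y ω) s ≤ x s} =
      (fun ω => (path U ω, Y ω)) ⁻¹' B := by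
    ext ω; simp [B, path]
  rw [hset, ← lintegral_indicator_one ((hUm.prodMk hY) hB)]
  have := lintegral_indepFun hUm hY hUY (f := fun u y => B.indicator 1 (u, y))
    ((measurable_one.indicator hB).comp (measurable_fst.prodMk measurable_snd))
  refine Eq.trans (lintegral_congr fun ω => ?_) (this.trans (lintegral_congr fun ω => ?_))
  · rfl
  · have hsec : MeasurableSet ((fun u => (u, Y ω)) ⁻¹' B) := measurable_prodMk_right hB
    have : ∫⁻ u, B.indicator 1 (u, Y ω) ∂(P.map (path U)) =
        P.map (path U) ((fun u => (u, Y ω)) ⁻¹' B) := by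
      rw [← lintegral_indicator_one hsec]
      rfl
    rw [this, Measure.map_apply hUm hsec, expNeg_sum]
    have hprod := (hU.indep.measure_inter_preimage_eq_mul F
      (sets := fun s => {t | ENNReal.ofReal (t / gammaConst p) * f (Y ω) s ≤ x s})
      fun s _ => measurableSet_le (by fun_prop) measurable_const)
    have h2 : path U ⁻¹' ((fun u => (u, Y ω)) ⁻¹' B) = ⋂ s ∈ F, U s ⁻¹'
        {t | ENNReal.ofReal (t / gammaConst p) * f (Y ω) s ≤ x s} := by
      ext ω'; simp [B, path]
    rw [h2, hprod]
    refine Finset.prod_congr rfl fun s _ => ?_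
    exact (hU.frechet s).measure_mul_le hp1 hp _ _ (hx s)

namespace IsStableNoise

variable {α : ℝ} {T : S → Ω → ℝ}

lemma lintegral_expNeg_mul (hT : IsStableNoise α T P) (hα : 0 < α) (s : S) {c : ℝ≥0∞}
    (hc : c ≠ ∞) :
    ∫⁻ ω, expNeg (ENNReal.ofReal (T s ω) * c) ∂P = expNeg (c ^ α) := by
  lift c to ℝ≥0 using hc
  have h := hT.laplace s c c.2
  have h1 : ∫⁻ ω, expNeg (ENNReal.ofReal (T s ω) * c) ∂P =
      ∫⁻ ω, ENNReal.ofReal (Real.exp (-(c * T s ω))) ∂P := by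
    apply lintegral_congr_ae
    filter_upwards [hT.nonneg s] with ω hω
    rw [← ENNReal.ofReal_coe_nnreal (p := c), ← ENNReal.ofReal_mul hω,
      expNeg_ofReal (by positivity), mul_comm]
  have hTm := hT.measurable s
  rw [h1, ← ofReal_integral_eq_lintegral_ofReal, h, ← ENNReal.ofReal_coe_nnreal (p := c),
    ENNReal.ofReal_rpow_of_nonneg c.coe_nonneg hα.le, expNeg_ofReal (by positivity)]
  · refine Integrable.of_bound (by fun_prop) 1 ?_
    filter_upwards [hT.nonneg s] with ω hω
    rw [Real.norm_eq_abs, Real.abs_exp, Real.exp_le_one_iff]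
    exact neg_nonpos.2 (mul_nonneg c.coe_nonneg hω)
  · exact ae_of_all _ fun ω => (Real.exp_pos _).le

/-- Integrating out the stable noise. -/
lemma lintegral_expNeg_sum {β : Type*} [MeasurableSpace β] (hT : IsStableNoise α T P)
    (hα : 0 < α) {Y : Ω → β} (hY : Measurable Y) (hTY : IndepFun (path T) Y P)
    {f : β → S → ℝ≥0∞} (hf : ∀ s, Measurable fun y => f y s) (F : Finset S)
    (hft : ∀ y, ∀ s ∈ F, f y s ≠ ∞) :
    ∫⁻ ω, expNeg (∑ s ∈ F, ENNReal.ofReal (T s ω) * f (Y ω) s) ∂P =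
      ∫⁻ ω, expNeg (∑ s ∈ F, f (Y ω) s ^ α) ∂P := by
  have hTm : Measurable (path T) := measurable_pi_iff.2 hT.measurable
  refine (lintegral_indepFun hTm hY hTY
    (f := fun t y => expNeg (∑ s ∈ F, ENNReal.ofReal (t s) * f y s)) ?_).trans ?_
  · refine measurable_expNeg.comp (Finset.measurable_fun_sum _ fun s _ => Measurable.mul ?_ ?_)
    · exact ((measurable_pi_apply s).comp measurable_fst).ennreal_ofReal
    · exact (hf s).comp measurable_snd
  · refine lintegral_congr fun ω => ?_
    rw [lintegral_map _ hTm]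
    · simp only [path, expNeg_sum]
      rw [iIndepFun.lintegral_finset_prod hT.measurable hT.indep F
        (g := fun s t => expNeg (ENNReal.ofReal t * f (Y ω) s)) (fun s => by fun_prop)]
      exact Finset.prod_congr rfl fun s hs => hT.lintegral_expNeg_mul hα s (hft _ s hs)
    · fun_prop

end IsStableNoise

end Independence

/-! ### Laws of processes with values in `[0, ∞]` -/

/-- The law of a `[0, ∞]`-valued process is determined by its finite-dimensional distribution
functions at nonzero arguments. -/
lemma map_eq_of_measure_le {S : Type u} {Ω : Type v} {Ω' : Type w} [MeasurableSpace Ω]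
    [MeasurableSpace Ω'] {P : Measure Ω} {P' : Measure Ω'} [IsProbabilityMeasure P]
    [IsProbabilityMeasure P'] {Y : Ω → S → ℝ≥0∞} {Y' : Ω' → S → ℝ≥0∞}
    (hY : Measurable Y) (hY' : Measurable Y')
    (h : ∀ (F : Finset S) (x : S → ℝ≥0∞), (∀ s, x s ≠ 0) →
      P {ω | ∀ s ∈ F, Y ω s ≤ x s} = P' {ω | ∀ s ∈ F, Y' ω s ≤ x s}) :
    P.map Y = P'.map Y' := by
  have := Measure.isProbabilityMeasure_map (μ := P) hY.aemeasurable
  have := Measure.isProbabilityMeasure_map (μ := P') hY'.aemeasurable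
  let C : S → Set (Set ℝ≥0∞) := fun _ => {B | ∃ x : ℝ≥0∞, x ≠ 0 ∧ B = Set.Iic x}
  have hC_pi (s : S) : IsPiSystem (C s) := by
    rintro _ ⟨x, hx, rfl⟩ _ ⟨y, hy, rfl⟩ -
    exact ⟨min x y, by simp [hx, hy, min_eq_iff], Set.Iic_inter_Iic⟩
  have hC_univ (s : S) : Set.univ ∈ C s := ⟨∞, by simp, Set.Iic_top.symm⟩
  refine ext_of_generate_finite (squareCylinders C) (le_antisymm ?_ ?_)
    (isPiSystem_squareCylinders hC_pi hC_univ) ?_ (by simp)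
  · -- The evaluations are measurable for the generated `σ`-algebra; `Iic 0` is a countable
    -- intersection of sets `Iic x` with `x ≠ 0`.
    refine iSup_le fun s => ?_
    rw [← measurable_iff_comap_le]
    have hIic (x : ℝ≥0∞) (hx : x ≠ 0) :
        MeasurableSet[MeasurableSpace.generateFrom (squareCylinders C)]
          ((fun y : S → ℝ≥0∞ => y s) ⁻¹' Set.Iic x) := by
      refine MeasurableSpace.measurableSet_generateFrom
        ⟨{s}, fun _ => Set.Iic x, fun i _ => ⟨x, hx, rfl⟩, ?_⟩
      ext y
      simp
    refine @measurable_of_Iic ℝ≥0∞ (S → ℝ≥0∞) _ _ _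
      (MeasurableSpace.generateFrom (squareCylinders C)) _ _ _ _ fun x => ?_
    rcases eq_or_ne x 0 with rfl | hx
    · have : (fun y : S → ℝ≥0∞ => y s) ⁻¹' Set.Iic 0 =
          ⋂ n : ℕ, (fun y : S → ℝ≥0∞ => y s) ⁻¹' Set.Iic ((n : ℝ≥0∞)⁻¹) := by
        ext y
        simp only [Set.mem_preimage, Set.mem_Iic, Set.mem_iInter]
        exact ⟨fun hy n => hy.trans (zero_le), fun hy =>
          ge_of_tendsto' ENNReal.tendsto_inv_nat_nhds_zero hy⟩
      rw [this]
      exact MeasurableSet.iInter fun n => hIic _ (by simp)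
    · exact hIic x hx
  · refine MeasurableSpace.generateFrom_le ?_
    rintro _ ⟨F, t, ht, rfl⟩
    refine MeasurableSet.pi F.countable_toSet fun s _ => ?_
    obtain ⟨x, -, hx⟩ := ht s trivial
    rw [hx]
    exact measurableSet_Iic
  · rintro _ ⟨F, t, ht, rfl⟩
    choose x hx0 hx using fun s => ht s trivial
    have hm : MeasurableSet ((F : Set S).pi t) :=
      MeasurableSet.pi F.countable_toSet fun s _ => by rw [hx s]; exact measurableSet_Iic
    rw [Measure.map_apply hY hm, Measure.map_apply hY' hm]
    convert h F x hx0 using 2 <;> · ext ω; simp [Set.mem_pi, hx]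

/-! ### Product spaces carrying the three independent families -/

lemma _root_.MeasureTheory.MeasurePreserving.iIndepFun_comp_iff {ι : Type*} {Ω Ω' : Type*}
    [MeasurableSpace Ω] [MeasurableSpace Ω'] {P : Measure Ω} {P' : Measure Ω'} {T : Ω' → Ω}
    (hT : MeasurePreserving T P' P) {β : ι → Type*} [∀ i, MeasurableSpace (β i)]
    {f : ∀ i, Ω → β i} (hf : ∀ i, Measurable (f i)) :
    iIndepFun (fun i ω => f i (T ω)) P' ↔ iIndepFun f P := by
  simp only [iIndepFun_iff_measure_inter_preimage_eq_mul]
  refine forall_congr' fun F => forall_congr' fun B => forall_congr' fun hB => ?_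
  rw [← hT.measure_preimage
    (Finset.measurableSet_biInter F fun i hi => hf i (hB i hi)).nullMeasurableSet]
  simp only [Set.preimage_iInter]
  rw [Finset.prod_congr rfl fun i hi =>
    (hT.measure_preimage (hf i (hB i hi)).nullMeasurableSet).symm]
  rfl

lemma _root_.MeasureTheory.MeasurePreserving.indepFun_comp {Ω Ω' : Type*}
    [MeasurableSpace Ω] [MeasurableSpace Ω'] {P : Measure Ω} {P' : Measure Ω'} {T : Ω' → Ω}
    (hT : MeasurePreserving T P' P) {α β : Type*} [MeasurableSpace α] [MeasurableSpace β]
    {f : Ω → α} {g : Ω → β} (hf : Measurable f) (hg : Measurable g) (h : IndepFun f g P) :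
    IndepFun (fun ω => f (T ω)) (fun ω => g (T ω)) P' := by
  rw [indepFun_iff_measure_inter_preimage_eq_mul] at h ⊢
  intro s t hs ht
  have := h s t hs ht
  rwa [← hT.measure_preimage (hf hs).nullMeasurableSet,
    ← hT.measure_preimage (hg ht).nullMeasurableSet,
    ← hT.measure_preimage ((hf hs).inter (hg ht)).nullMeasurableSet] at this

/-- The number of terms of a sequence that lie in `B`. -/
noncomputable def countIn (B : Set ℝ) (a : ℕ → ℝ) : ℝ≥0∞ := ∑' i, B.indicator 1 (a i)

lemma measurable_countIn {B : Set ℝ} (hB : MeasurableSet B) : Measurable (countIn B) :=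
  Measurable.tsum fun i => (measurable_one.indicator hB).comp (measurable_pi_apply i)

lemma pointProcess_apply {Ω : Type v} (A : ℕ → Ω → ℝ) (ω : Ω) {B : Set ℝ}
    (hB : MeasurableSet B) : pointProcess A ω B = countIn B (path A ω) := by
  simp [pointProcess, countIn, path, Measure.sum_apply _ hB, Measure.dirac_apply' _ hB]

/-- Being a Poisson process is a property of the law of the enumerated points. -/
lemma IsPoissonProcess.of_map_eq {Ω : Type v} {Ω' : Type w} [MeasurableSpace Ω]
    [MeasurableSpace Ω'] {P : Measure Ω} {P' : Measure Ω'} {A : ℕ → Ω → ℝ} {A' : ℕ → Ω' → ℝ}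
    (hA : IsPoissonProcess A P) (hA' : ∀ i, Measurable (A' i))
    (h : P'.map (path A') = P.map (path A)) : IsPoissonProcess A' P' := by
  have hm : Measurable (path A) := measurable_pi_iff.2 hA.measurable
  have hm' : Measurable (path A') := measurable_pi_iff.2 hA'
  have hT : MeasurePreserving (path A) P (P.map (path A)) := ⟨hm, rfl⟩
  have hT' : MeasurePreserving (path A') P' (P.map (path A)) := ⟨hm', h⟩
  refine ⟨hA', ?_, fun B hB hBt n => ?_, fun n B hB hBd => ?_⟩
  · have hpos : MeasurableSet {a : ℕ → ℝ | ∀ i, 0 < a i} := by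
      rw [Set.ofPred_forall]
      exact MeasurableSet.iInter fun i =>
        measurableSet_lt measurable_const (measurable_pi_apply i)
    have h1 : ∀ᵐ a ∂(P.map (path A)), ∀ i, 0 < a i :=
      (ae_map_iff hm.aemeasurable hpos).2 hA.pos
    rw [← h] at h1
    exact (ae_map_iff hm'.aemeasurable hpos).1 h1
  · rw [← hA.poisson B hB hBt n]
    have hs : MeasurableSet {a | countIn B a = n} :=
      measurable_countIn hB (measurableSet_singleton _)
    simp only [pointProcess_apply _ _ hB]
    exact (hT'.measure_preimage hs.nullMeasurableSet).trans
      (hT.measure_preimage hs.nullMeasurableSet).symm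
  · have h1 := hA.indep n B hB hBd
    simp only [pointProcess_apply _ _ (hB _)] at h1 ⊢
    have hc := fun j => measurable_countIn (hB j)
    exact (hT'.iIndepFun_comp_iff hc).2 ((hT.iIndepFun_comp_iff hc).1 h1)

/-- Existence of independent families `U`, `A`, `V'` with `U` independent with marginal laws `ν`,
`A` a copy of a given Poisson process and `V'` a sequence of independent copies of `V`. -/
lemma exists_independent_families {S : Type u} {Ω : Type v} [MeasurableSpace Ω] {P : Measure Ω}
    [IsProbabilityMeasure P] {A : ℕ → Ω → ℝ} (hA : IsPoissonProcess A P) {E : Type w}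
    [MeasurableSpace E] {Q : Measure E} [IsProbabilityMeasure Q] {V : S → E → ℝ}
    (hV : ∀ s, Measurable (V s)) (ν : S → Measure ℝ) [∀ s, IsProbabilityMeasure (ν s)] :
    ∃ (Ω' : Type u) (_ : MeasurableSpace Ω') (P' : Measure Ω') (U : S → Ω' → ℝ)
      (A' : ℕ → Ω' → ℝ) (V' : ℕ → S → Ω' → ℝ),
      IsProbabilityMeasure P' ∧ (∀ s, Measurable (U s)) ∧ (∀ s, P'.map (U s) = ν s) ∧
      iIndepFun U P' ∧ IsPoissonProcess A' P' ∧ P'.map (path A') = P.map (path A) ∧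
      IsIndepCopies V' P' V Q ∧
      IndepFun (path A') (fun ω i s => V' i s ω) P' ∧
      IndepFun (path U) (fun ω => (path A' ω, fun (i : ℕ) (s : S) => V' i s ω)) P' := by
  have hAm : Measurable (path A) := measurable_pi_iff.2 hA.measurable
  have hVm : Measurable (path V) := measurable_pi_iff.2 hV
  have := Measure.isProbabilityMeasure_map (μ := P) hAm.aemeasurable
  have := Measure.isProbabilityMeasure_map (μ := Q) hVm.aemeasurable
  let PV : Measure (ℕ → S → ℝ) := Measure.infinitePi fun _ => Q.map (path V)
  let PAV : Measure ((ℕ → ℝ) × (ℕ → S → ℝ)) := (P.map (path A)).prod PV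
  let PU : Measure (S → ℝ) := Measure.infinitePi ν
  have h1 : MeasurePreserving Prod.fst (PU.prod PAV) PU := measurePreserving_fst
  have h2 : MeasurePreserving Prod.snd (PU.prod PAV) PAV := measurePreserving_snd
  have hfst : MeasurePreserving Prod.fst PAV (P.map (path A)) := measurePreserving_fst
  have hsnd : MeasurePreserving Prod.snd PAV PV := measurePreserving_snd
  have hmapA : (PU.prod PAV).map (path fun (i : ℕ) z => z.2.1 i) = P.map (path A) :=
    (hfst.comp h2).map_eq
  refine ⟨(S → ℝ) × ((ℕ → ℝ) × (ℕ → S → ℝ)), inferInstance, PU.prod PAV, fun s z => z.1 s,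
    fun i z => z.2.1 i, fun i s z => z.2.2 i s, inferInstance, fun s => by fun_prop, fun s => ?_,
    ?_, hA.of_map_eq (fun i => by fun_prop) hmapA, hmapA, ⟨fun i s => by fun_prop, fun i => ?_, ?_⟩,
    ?_, ?_⟩
  · exact ((measurePreserving_eval_infinitePi ν s).comp h1).map_eq
  · exact (h1.iIndepFun_comp_iff fun s => measurable_pi_apply s).2
      (iIndepFun_infinitePi (P := ν) (X := fun _ x => x) fun _ => measurable_id)
  · have h3 := (measurePreserving_eval_infinitePi (fun _ : ℕ => Q.map (path V)) i).comp
      (hsnd.comp h2)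
    exact ⟨h3.measurable.aemeasurable, hVm.aemeasurable, h3.map_eq⟩
  · exact ((hsnd.comp h2).iIndepFun_comp_iff
      (f := fun (i : ℕ) (y : ℕ → S → ℝ) => y i) fun i => measurable_pi_apply i).2
      (iIndepFun_infinitePi (P := fun _ : ℕ => Q.map (path V)) (X := fun _ x => x)
        fun _ => measurable_id)
  · exact h2.indepFun_comp (f := Prod.fst) (g := Prod.snd) measurable_fst measurable_snd
      (indepFun_prod (μ := P.map (path A)) (ν := PV) (X := id) (Y := id)
        measurable_id measurable_id)
  · exact indepFun_prod (μ := PU) (ν := PAV) (X := id) (Y := id) measurable_id measurable_id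

/-- Existence of a copy of `W` independent of a noise with marginal laws `ν`. -/
lemma exists_independent_copy {S : Type u} {E : Type w}
    [MeasurableSpace E] {Q : Measure E} [IsProbabilityMeasure Q] {W : S → E → ℝ}
    (hW : ∀ s, Measurable (W s)) (ν : S → Measure ℝ) [∀ s, IsProbabilityMeasure (ν s)] :
    ∃ (E' : Type u) (_ : MeasurableSpace E') (R : Measure E') (U W' : S → E' → ℝ),
      IsProbabilityMeasure R ∧ (∀ s, Measurable (U s)) ∧ (∀ s, R.map (U s) = ν s) ∧
      iIndepFun U R ∧ IsIndepCopy U W' R W Q := by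
  have hWm : Measurable (path W) := measurable_pi_iff.2 hW
  have := Measure.isProbabilityMeasure_map (μ := Q) hWm.aemeasurable
  let PU : Measure (S → ℝ) := Measure.infinitePi ν
  have h1 : MeasurePreserving Prod.fst (PU.prod (Q.map (path W))) PU := measurePreserving_fst
  have h2 : MeasurePreserving Prod.snd (PU.prod (Q.map (path W))) (Q.map (path W)) :=
    measurePreserving_snd
  refine ⟨(S → ℝ) × (S → ℝ), inferInstance, PU.prod (Q.map (path W)), fun s z => z.1 s,
    fun s z => z.2 s, inferInstance, fun s => by fun_prop, fun s => ?_, ?_,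
    ⟨fun s => by fun_prop, ⟨h2.measurable.aemeasurable, hWm.aemeasurable, h2.map_eq⟩, ?_⟩⟩
  · exact ((measurePreserving_eval_infinitePi ν s).comp h1).map_eq
  · exact (h1.iIndepFun_comp_iff fun s => measurable_pi_apply s).2
      (iIndepFun_infinitePi (P := ν) (X := fun _ x => x) fun _ => measurable_id)
  · exact indepFun_prod (μ := PU) (ν := Q.map (path W)) (X := id) (Y := id) measurable_id
      measurable_id

lemma IsFrechet.of_map_eq {Ω : Type v} [MeasurableSpace Ω] {P : Measure Ω} {p : ℝ≥0∞}
    (hp1 : 1 < p) (hp : p < ∞) {Y : Ω → ℝ} (hY : Measurable Y)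
    (h : P.map Y = frechetMeasure p.toReal) : IsFrechet p Y P := by
  refine ⟨hY, fun x => ?_⟩
  rw [← frechetMeasure_Iic hp1 hp, ← h, Measure.map_apply hY measurableSet_Iic]
  rfl

/-! ### Finite-dimensional distributions of the representations -/

/-- The exponent `∑ₛ (a w(s) / (Γ(1 - 1/p) x(s))) ^ p` contributed by the point `a` with mark `w` to
the joint distribution function of an `ℓ^p` representation at `x`. -/
noncomputable def lpExponent {S : Type u} (p : ℝ≥0∞) (F : Finset S) (x : S → ℝ≥0∞) (a : ℝ)
    (w : S → ℝ) : ℝ≥0∞ :=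
  ∑ s ∈ F, (ENNReal.ofReal (a * w s) / (ENNReal.ofReal (gammaConst p) * x s)) ^ p.toReal

lemma measurable_lpExponent {S : Type u} (p : ℝ≥0∞) (F : Finset S) (x : S → ℝ≥0∞) :
    Measurable fun z : ℝ × (S → ℝ) => lpExponent p F x z.1 z.2 := by
  unfold lpExponent
  fun_prop

lemma measurable_lpExponent_right {S : Type u} (p : ℝ≥0∞) (F : Finset S) (x : S → ℝ≥0∞) (a : ℝ) :
    Measurable (lpExponent p F x a) := by
  unfold lpExponent
  fun_prop

/-- The `p`-th power of the `ℓ^p` norm is additive over the points; this is what makes the joint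
distribution function a product over the points. -/
lemma seqNorm_div_rpow {p : ℝ≥0∞} (hp0 : p ≠ 0) (hp : p < ∞) (y : ℕ → ℝ) (c : ℝ≥0∞) :
    (seqNorm p y / c) ^ p.toReal = ∑' i, (ENNReal.ofReal (y i) / c) ^ p.toReal := by
  have hr : 0 < p.toReal := ENNReal.toReal_pos hp0 hp.ne
  rw [seqNorm, if_neg hp.ne, ENNReal.div_rpow_of_nonneg _ _ hr.le, ← ENNReal.rpow_mul,
    one_div_mul_cancel hr.ne', ENNReal.rpow_one, div_eq_mul_inv, ← ENNReal.tsum_mul_right]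
  simp only [← div_eq_mul_inv, ENNReal.div_rpow_of_nonneg _ _ hr.le]

lemma measurable_seqNorm (p : ℝ≥0∞) : Measurable (seqNorm p) := by
  unfold seqNorm
  split_ifs
  · exact Measurable.iSup fun i => (measurable_pi_apply i).ennreal_ofReal
  · exact (Measurable.tsum fun i =>
      ((measurable_pi_apply i).ennreal_ofReal).pow_const _).pow_const _

lemma measurable_lpProcess {S : Type u} {Ω : Type v} [MeasurableSpace Ω] (p : ℝ≥0∞)
    {U : S → Ω → ℝ} {A : ℕ → Ω → ℝ} {W : ℕ → S → Ω → ℝ} (hU : ∀ s, Measurable (U s))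
    (hA : ∀ i, Measurable (A i)) (hW : ∀ i s, Measurable (W i s)) :
    Measurable fun ω s => ENNReal.ofReal (U s ω / gammaConst p) *
      seqNorm p (fun i => A i ω * W i s ω) :=
  measurable_pi_iff.2 fun s => ((hU s).div_const _).ennreal_ofReal.mul
    ((measurable_seqNorm p).comp (measurable_pi_iff.2 fun i => (hA i).mul (hW i s)))

section

variable {S : Type u} {Ω : Type v} [MeasurableSpace Ω] {P : Measure Ω} [IsProbabilityMeasure P]
  {E : Type w} [MeasurableSpace E] {Q : Measure E} [IsProbabilityMeasure Q]
  {A : ℕ → Ω → ℝ} {W : S → E → ℝ} {W' : ℕ → S → Ω → ℝ}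

/-- The finite-dimensional distribution functions of an `ℓ^p` representation. -/
lemma measure_lpRepresentation_le {p : ℝ≥0∞} (hp1 : 1 < p) (hp : p < ∞) {U : S → Ω → ℝ}
    (hU : IsFrechetNoise p U P) (hA : ∀ i, Measurable (A i)) (hW : ∀ s, Measurable (W s))
    (hW' : IsIndepCopies W' P W Q)
    (hAW : IndepFun (path A) (fun ω i s => W' i s ω) P)
    (hU_AW : IndepFun (path U) (fun ω => (path A ω, fun (i : ℕ) (s : S) => W' i s ω)) P)
    (F : Finset S) {x : S → ℝ≥0∞} (hx : ∀ s, x s ≠ 0) :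
    P {ω | ∀ s ∈ F, ENNReal.ofReal (U s ω / gammaConst p) *
        seqNorm p (fun i => A i ω * W' i s ω) ≤ x s} =
      ∫⁻ a, ⨅ n, ∏ i ∈ Finset.range n, ∫⁻ ω, expNeg (lpExponent p F x (a i) (path W ω)) ∂Q
        ∂(P.map (path A)) := by
  have hWm : Measurable (path W) := measurable_pi_iff.2 hW
  have hAm : Measurable (path A) := measurable_pi_iff.2 hA
  have hWi (i : ℕ) : Measurable (path (W' i)) := measurable_pi_iff.2 (hW'.measurable i)
  have hW'm : Measurable fun ω (i : ℕ) (s : S) => W' i s ω :=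
    measurable_pi_iff.2 hWi
  have := Measure.isProbabilityMeasure_map (μ := Q) hWm.aemeasurable
  have hf (s : S) : Measurable fun y : (ℕ → ℝ) × (ℕ → S → ℝ) =>
      seqNorm p fun i => y.1 i * y.2 i s := by
    refine (measurable_seqNorm p).comp (measurable_pi_iff.2 fun i => ?_)
    fun_prop
  refine (hU.measure_mul_le hp1 hp (hAm.prodMk hW'm) hU_AW
    (f := fun y s => seqNorm p fun i => y.1 i * y.2 i s) hf F hx).trans ?_
  have hp0 : p ≠ 0 := (zero_lt_one.trans hp1).ne'
  have hsum (ω : Ω) : ∑ s ∈ F, (seqNorm p (fun i => path A ω i * W' i s ω) /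
      (ENNReal.ofReal (gammaConst p) * x s)) ^ p.toReal =
      ∑' i, lpExponent p F x (A i ω) (path (W' i) ω) := by
    simp only [seqNorm_div_rpow hp0 hp, lpExponent]
    rw [Summable.tsum_finsetSum fun _ _ => ENNReal.summable]
    rfl
  simp only [hsum]
  rw [lintegral_expNeg_tsum (W := fun i => path (W' i)) hA hWi hW'.indep
    (fun i => (hW'.copy i).map_eq) hAW (measurable_lpExponent p F x)]
  refine lintegral_congr fun a => ?_
  congr 1
  ext n
  refine Finset.prod_congr rfl fun i _ => ?_
  exact lintegral_map (measurable_expNeg.comp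
    (measurable_lpExponent_right p F x _)) hWm

/-- The finite-dimensional distribution functions of a de Haan representation. -/
lemma measure_deHaanRepresentation_le (hA : ∀ i, Measurable (A i)) (hW : ∀ s, Measurable (W s))
    (hW' : IsIndepCopies W' P W Q) (hAW : IndepFun (path A) (fun ω i s => W' i s ω) P)
    (F : Finset S) (x : S → ℝ≥0∞) :
    P {ω | ∀ s ∈ F, ⨆ i, ENNReal.ofReal (A i ω * W' i s ω) ≤ x s} =
      ∫⁻ a, ⨅ n, ∏ i ∈ Finset.range n, Q {ω | ∀ s ∈ F, ENNReal.ofReal (a i * W s ω) ≤ x s}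
        ∂(P.map (path A)) := by
  classical
  have hWm : Measurable (path W) := measurable_pi_iff.2 hW
  have hWi (i : ℕ) : Measurable (path (W' i)) := measurable_pi_iff.2 (hW'.measurable i)
  have := Measure.isProbabilityMeasure_map (μ := Q) hWm.aemeasurable
  let B : Set (ℝ × (S → ℝ)) := ⋂ s ∈ F, {z | ENNReal.ofReal (z.1 * z.2 s) ≤ x s}
  have hB : MeasurableSet B :=
    Finset.measurableSet_biInter _ fun s _ => measurableSet_le (by fun_prop) measurable_const
  have hmemB (a : ℝ) (w : S → ℝ) : (a, w) ∈ B ↔ ∀ s ∈ F, ENNReal.ofReal (a * w s) ≤ x s := by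
    simp [B]
  -- The event is `∑ᵢ φ(Aᵢ, Wᵢ) = 0`, where `φ` is `0` on `B` and `∞` elsewhere.
  let φ : ℝ → (S → ℝ) → ℝ≥0∞ := fun a w => Bᶜ.indicator (fun _ => ∞) (a, w)
  have hφ : Measurable fun z : ℝ × (S → ℝ) => φ z.1 z.2 :=
    measurable_const.indicator hB.compl
  have hexp (a : ℝ) (w : S → ℝ) : expNeg (φ a w) = B.indicator 1 (a, w) := by
    by_cases h : (a, w) ∈ B <;> simp [φ, h]
  have hset : {ω | ∀ s ∈ F, ⨆ i, ENNReal.ofReal (A i ω * W' i s ω) ≤ x s} =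
      ⋂ i, (fun ω => (A i ω, path (W' i) ω)) ⁻¹' B := by
    ext ω
    simp only [Set.mem_ofPred_eq, iSup_le_iff, Set.mem_iInter, Set.mem_preimage, hmemB, path]
    exact ⟨fun h i s hs => h s hs i, fun h s hs i => h i s hs⟩
  have hsm : MeasurableSet (⋂ i, (fun ω => (A i ω, path (W' i) ω)) ⁻¹' B) :=
    MeasurableSet.iInter fun i => ((hA i).prodMk (hWi i)) hB
  rw [hset, ← lintegral_indicator_one hsm]
  refine Eq.trans (lintegral_congr fun ω => ?_) ((lintegral_expNeg_tsum (W := fun i => path (W' i))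
    hA hWi hW'.indep (fun i => (hW'.copy i).map_eq) hAW hφ).trans (lintegral_congr fun a => ?_))
  · by_cases h : ∀ i, (A i ω, path (W' i) ω) ∈ B
    · have h0 : ∀ i, φ (A i ω) (path (W' i) ω) = 0 := fun i => by simp [φ, h i]
      simp [h0, h]
    · obtain ⟨i, hi⟩ := not_forall.1 h
      have h0 : φ (A i ω) (path (W' i) ω) = ∞ := by simp [φ, hi]
      rw [ENNReal.tsum_eq_top_of_eq_top ⟨i, h0⟩, expNeg_top, Set.indicator_of_notMem]
      simpa using ⟨i, hi⟩
  · congr 1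
    ext n
    refine Finset.prod_congr rfl fun i _ => ?_
    have hsec : MeasurableSet (Prod.mk (a i) ⁻¹' B) := measurable_prodMk_left hB
    have h1 : ∫⁻ w, expNeg (φ (a i) w) ∂(Q.map (path W)) =
        Q.map (path W) (Prod.mk (a i) ⁻¹' B) := by
      rw [← lintegral_indicator_one hsec]
      exact lintegral_congr fun w => hexp _ _
    rw [h1, Measure.map_apply hWm hsec]
    congr 1
    ext ω
    simp only [Set.mem_preimage, hmemB]
    rfl

end

/-! ### The one-point identities -/

lemma IsIndepCopy.lintegral_lpExponent {S : Type u} {E : Type w} [MeasurableSpace E]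
    {Q : Measure E} {W : S → E → ℝ} {E' : Type z} [MeasurableSpace E'] {ρ : Measure E'}
    {W' : S → E' → ℝ} {Z : S → E' → ℝ} (h : IsIndepCopy Z W' ρ W Q)
    (p : ℝ≥0∞) (F : Finset S) (x : S → ℝ≥0∞) (a : ℝ) :
    ∫⁻ ω, expNeg (lpExponent p F x a (path W' ω)) ∂ρ =
      ∫⁻ ω, expNeg (lpExponent p F x a (path W ω)) ∂Q :=
  (h.copy.comp (u := fun w => expNeg (lpExponent p F x a w)) (measurable_expNeg.comp
    (measurable_lpExponent_right p F x _))).lintegral_eq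

section

variable {S : Type u} {E : Type w} [MeasurableSpace E] {Q : Measure E}
  {W : S → E → ℝ} {E' : Type z} [MeasurableSpace E'] {ρ : Measure E'} [IsProbabilityMeasure ρ]
  {W' : S → E' → ℝ}

/-- A single Fréchet-perturbed point of the de Haan representation contributes the same factor as a
single point of the `ℓ^p` representation. -/
lemma measure_frechet_mul_le {p : ℝ≥0∞} (hp1 : 1 < p) (hp : p < ∞) {U : S → E' → ℝ}
    (hU : IsFrechetNoise p U ρ) (h : IsIndepCopy U W' ρ W Q) (F : Finset S) {x : S → ℝ≥0∞}
    (hx : ∀ s, x s ≠ 0) (a : ℝ) :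
    ρ {ω | ∀ s ∈ F, ENNReal.ofReal (a * (U s ω / gammaConst p * W' s ω)) ≤ x s} =
      ∫⁻ ω, expNeg (lpExponent p F x a (path W ω)) ∂Q := by
  rw [← h.lintegral_lpExponent]
  have hWm : Measurable (path W') := measurable_pi_iff.2 h.measurable
  refine Eq.trans ?_ (hU.measure_mul_le hp1 hp hWm h.indep
    (f := fun w s => ENNReal.ofReal (a * w s)) (fun s => by fun_prop) F hx)
  apply measure_congr
  have hpos : ∀ᵐ ω ∂ρ, ∀ s ∈ F, 0 < U s ω :=
    (Finset.eventually_all F).2 fun s _ => (hU.frechet s).ae_pos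
  filter_upwards [hpos] with ω hω
  refine propext (forall₂_congr fun s hs => ?_)
  rw [← ENNReal.ofReal_mul (div_pos (hω s hs) (gammaConst_pos hp1)).le, path]
  ring_nf

/-- A single stably perturbed point of the `ℓ^q` representation contributes the same factor as a
single point of the `ℓ^p` representation. -/
lemma lintegral_stable_lpExponent {p q : ℝ≥0∞} (hp1 : 1 < p) (hpq : p < q) (hq : q < ∞)
    {T : S → E' → ℝ} (hT : IsStableNoise (p.toReal / q.toReal) T ρ)
    (h : IsIndepCopy T W' ρ W Q) (F : Finset S) {x : S → ℝ≥0∞} (hx : ∀ s, x s ≠ 0) (a : ℝ) :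
    ∫⁻ ω, expNeg (lpExponent q F x a (fun s => gammaConst q / gammaConst p *
      T s ω ^ (1 / q.toReal) * W' s ω)) ∂ρ =
      ∫⁻ ω, expNeg (lpExponent p F x a (path W ω)) ∂Q := by
  have hp : p < ∞ := hpq.trans hq
  have hpr : 0 < p.toReal := ENNReal.toReal_pos (zero_lt_one.trans hp1).ne' hp.ne
  have hqr : 0 < q.toReal := ENNReal.toReal_pos (zero_lt_one.trans (hp1.trans hpq)).ne' hq.ne
  have hcp := gammaConst_pos hp1
  have hcq := gammaConst_pos (hp1.trans hpq)
  have hcp' : ENNReal.ofReal (gammaConst p) ≠ 0 := by simpa using hcp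
  have hcq' : ENNReal.ofReal (gammaConst q) ≠ 0 := by simpa using hcq
  rw [← h.lintegral_lpExponent]
  have hWm : Measurable (path W') := measurable_pi_iff.2 h.measurable
  let f : (S → ℝ) → S → ℝ≥0∞ := fun w s =>
    (ENNReal.ofReal (a * w s) / (ENNReal.ofReal (gammaConst p) * x s)) ^ q.toReal
  have hft (y : S → ℝ) (s : S) : f y s ≠ ∞ :=
    ENNReal.rpow_ne_top_of_nonneg hqr.le
      (ENNReal.div_ne_top ENNReal.ofReal_ne_top (mul_ne_zero hcp' (hx s)))
  have key := hT.lintegral_expNeg_sum (div_pos hpr hqr) hWm h.indep (f := f)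
    (fun s => by fun_prop) F fun y s _ => hft y s
  refine Eq.trans (lintegral_congr_ae ?_) (key.trans (lintegral_congr fun ω => ?_))
  · have hpos : ∀ᵐ ω ∂ρ, ∀ s ∈ F, 0 ≤ T s ω :=
      (Finset.eventually_all F).2 fun s _ => hT.nonneg s
    filter_upwards [hpos] with ω hω
    refine congrArg expNeg (Finset.sum_congr rfl fun s hs => ?_)
    have hT0 := hω s hs
    have h1 : a * (gammaConst q / gammaConst p * T s ω ^ (1 / q.toReal) * W' s ω) =
        T s ω ^ (1 / q.toReal) * (gammaConst q / gammaConst p) * (a * W' s ω) := by ring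
    have h2 : ENNReal.ofReal (T s ω) = ENNReal.ofReal (T s ω ^ (1 / q.toReal)) ^ q.toReal := by
      rw [ENNReal.ofReal_rpow_of_nonneg (by positivity) hqr.le, ← Real.rpow_mul hT0,
        one_div_mul_cancel hqr.ne', Real.rpow_one]
    rw [h1, h2, ENNReal.ofReal_mul (by positivity), ENNReal.ofReal_mul (by positivity),
      ← ENNReal.mul_rpow_of_nonneg _ _ hqr.le, ENNReal.ofReal_div_of_pos hcp]
    congr 1
    simp only [path, div_eq_mul_inv]
    rw [ENNReal.mul_inv (Or.inl hcq') (Or.inl ENNReal.ofReal_ne_top),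
      ENNReal.mul_inv (Or.inl hcp') (Or.inl ENNReal.ofReal_ne_top)]
    calc _ = (ENNReal.ofReal (gammaConst q) * (ENNReal.ofReal (gammaConst q))⁻¹) *
        (ENNReal.ofReal (T s ω ^ (1 * q.toReal⁻¹)) * (ENNReal.ofReal (a * W' s ω) *
          ((ENNReal.ofReal (gammaConst p))⁻¹ * (x s)⁻¹))) := by ring
      _ = _ := by rw [ENNReal.mul_inv_cancel hcq' ENNReal.ofReal_ne_top, one_mul]
  · refine congrArg expNeg (Finset.sum_congr rfl fun s _ => ?_)
    rw [← ENNReal.rpow_mul, mul_div_cancel₀ _ hqr.ne']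

end

/-! ### Means of the multipliers -/

lemma isFrechet_id_frechetMeasure {p : ℝ≥0∞} (hp1 : 1 < p) (hp : p < ∞) :
    IsFrechet p (fun u : ℝ => u) (frechetMeasure p.toReal) :=
  IsFrechet.of_map_eq hp1 hp measurable_id Measure.map_id

lemma lintegral_frechetMeasure_div {p : ℝ≥0∞} (hp1 : 1 < p) (hp : p < ∞) :
    ∫⁻ u, ENNReal.ofReal (u / gammaConst p) ∂(frechetMeasure p.toReal) = 1 := by
  have hc := gammaConst_pos hp1
  have hc' : ENNReal.ofReal (gammaConst p) ≠ 0 := by simpa using hc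
  simp only [ENNReal.ofReal_div_of_pos hc]
  simp only [div_eq_mul_inv]
  rw [lintegral_mul_const _ (by fun_prop),
    (isFrechet_id_frechetMeasure hp1 hp).lintegral_ofReal hp1 hp,
    ENNReal.mul_inv_cancel hc' ENNReal.ofReal_ne_top]

/-- The moment `E T ^ (1/q) = Γ(1 - 1/p) / Γ(1 - 1/q)` of a positive `p/q`-stable variable `T`. If
`U` has law `Φ_q` and is independent of `T`, then `U T ^ (1/q)` has law `Φ_p`, and the means of both
Fréchet laws are known. -/
lemma IsStableNoise.lintegral_rpow {S : Type u} {Ω : Type v} [MeasurableSpace Ω] {P : Measure Ω}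
    [IsProbabilityMeasure P] {p q : ℝ≥0∞} (hp1 : 1 < p) (hpq : p < q) (hq : q < ∞)
    {T : S → Ω → ℝ} (hT : IsStableNoise (p.toReal / q.toReal) T P) (s : S) :
    ∫⁻ ω, ENNReal.ofReal (T s ω ^ (1 / q.toReal)) ∂P =
      ENNReal.ofReal (gammaConst p / gammaConst q) := by
  have hp : p < ∞ := hpq.trans hq
  have hq1 : 1 < q := hp1.trans hpq
  have hpr : 0 < p.toReal := ENNReal.toReal_pos (zero_lt_one.trans hp1).ne' hp.ne
  have hqr : 0 < q.toReal := ENNReal.toReal_pos (zero_lt_one.trans hq1).ne' hq.ne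
  have hcp := gammaConst_pos hp1
  have hcq := gammaConst_pos hq1
  have hcp' : ENNReal.ofReal (gammaConst p) ≠ 0 := by simpa using hcp
  have hcq' : ENNReal.ofReal (gammaConst q) ≠ 0 := by simpa using hcq
  have hTm := hT.measurable s
  -- Both processes are indexed by a point. `Y` is `U T ^ (1/q) / Γ(1 - 1/q)` with `U` of law
  -- `Φ_q`, and `Y'` is the multiple of a `Φ_p` variable that has the same law.
  let c := ENNReal.ofReal (gammaConst p / gammaConst q)
  let Y : Ω × ℝ → Unit → ℝ≥0∞ := fun z _ =>
    ENNReal.ofReal (z.2 / gammaConst q) * ENNReal.ofReal (T s z.1 ^ (1 / q.toReal))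
  let Y' : ℝ → Unit → ℝ≥0∞ := fun u _ => ENNReal.ofReal (u / gammaConst p) * c
  have hY : Measurable Y := measurable_pi_iff.2 fun _ => by fun_prop
  have hY' : Measurable Y' := measurable_pi_iff.2 fun _ => by fun_prop
  have hlaw : (P.prod (frechetMeasure q.toReal)).map Y = (frechetMeasure p.toReal).map Y' := by
    refine map_eq_of_measure_le hY hY' fun F x hx => ?_
    rcases F.eq_empty_or_nonempty with rfl | hF
    · simp
    have hFu : F = {()} := by
      obtain ⟨t, ht⟩ := hF
      ext; simp [ht]
    subst hFu
    have hx0 := hx ()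
    have hcollapse (y : Unit → ℝ≥0∞) :
        (∀ t ∈ ({()} : Finset Unit), y t ≤ x t) ↔ y () ≤ x () := by
      exact ⟨fun h => h () (by simp), fun h _ _ => h⟩
    simp only [hcollapse]
    generalize x () = r at hx0
    have hr0 : ENNReal.ofReal (gammaConst q) * r ≠ 0 := mul_ne_zero hcq' hx0
    have h1 : frechetMeasure p.toReal {u | Y' u () ≤ r} =
        expNeg ((1 / (ENNReal.ofReal (gammaConst q) * r)) ^ p.toReal) := by
      refine ((isFrechet_id_frechetMeasure hp1 hp).measure_mul_le hp1 hp c r hx0).trans ?_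
      congr 2
      simp only [c, ENNReal.ofReal_div_of_pos hcq, div_eq_mul_inv, one_mul]
      rw [ENNReal.mul_inv (Or.inl hcq') (Or.inl ENNReal.ofReal_ne_top),
        ENNReal.mul_inv (Or.inl hcp') (Or.inl ENNReal.ofReal_ne_top)]
      calc _ = (ENNReal.ofReal (gammaConst p) * (ENNReal.ofReal (gammaConst p))⁻¹) *
          ((ENNReal.ofReal (gammaConst q))⁻¹ * r⁻¹) := by ring
        _ = _ := by rw [ENNReal.mul_inv_cancel hcp' ENNReal.ofReal_ne_top, one_mul]
    have hset : MeasurableSet {z | Y z () ≤ r} :=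
      measurableSet_le ((measurable_pi_apply ()).comp hY) measurable_const
    rw [h1, Measure.prod_apply hset]
    have hne : (1 / (ENNReal.ofReal (gammaConst q) * r)) ^ q.toReal ≠ ∞ :=
      ENNReal.rpow_ne_top_of_nonneg hqr.le (ENNReal.div_ne_top ENNReal.one_ne_top hr0)
    have h2 := hT.lintegral_expNeg_mul (div_pos hpr hqr) s hne
    rw [← ENNReal.rpow_mul, mul_div_cancel₀ _ hqr.ne'] at h2
    rw [← h2]
    refine lintegral_congr_ae ?_
    filter_upwards [hT.nonneg s] with ω hω
    refine ((isFrechet_id_frechetMeasure hq1 hq).measure_mul_le hq1 hq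
      (ENNReal.ofReal (T s ω ^ (1 / q.toReal))) r hx0).trans ?_
    rw [ENNReal.div_rpow_of_nonneg _ _ hqr.le, ENNReal.ofReal_rpow_of_nonneg (by positivity) hqr.le,
      ← Real.rpow_mul hω, one_div_mul_cancel hqr.ne', Real.rpow_one,
      ENNReal.div_rpow_of_nonneg _ _ hqr.le, ENNReal.one_rpow, one_div, div_eq_mul_inv]
  have h3 := lintegral_map (μ := P.prod (frechetMeasure q.toReal))
    (measurable_pi_apply (X := fun _ => ℝ≥0∞) ()) hY
  rw [hlaw, lintegral_map (measurable_pi_apply (X := fun _ => ℝ≥0∞) ()) hY'] at h3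
  have h4 : ∫⁻ u, Y' u () ∂(frechetMeasure p.toReal) = c := by
    simp only [Y']
    rw [lintegral_mul_const _ (by fun_prop), lintegral_frechetMeasure_div hp1 hp, one_mul]
  have h5 : ∫⁻ z, Y z () ∂(P.prod (frechetMeasure q.toReal)) =
      ∫⁻ ω, ENNReal.ofReal (T s ω ^ (1 / q.toReal)) ∂P := by
    simp only [Y, mul_comm (ENNReal.ofReal (_ / gammaConst q))]
    rw [lintegral_prod_mul (f := fun ω => ENNReal.ofReal (T s ω ^ (1 / q.toReal)))
      (g := fun u => ENNReal.ofReal (u / gammaConst q)) (by fun_prop) (by fun_prop),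
      lintegral_frechetMeasure_div hq1 hq, mul_one]
  rw [← h5, ← h3, h4]

section

variable {S : Type u} {E : Type w} [MeasurableSpace E] {Q : Measure E}
  {W : S → E → ℝ} {E' : Type z} [MeasurableSpace E'] {ρ : Measure E'} {Z W' : S → E' → ℝ}

lemma IsIndepCopy.spectral (h : IsIndepCopy Z W' ρ W Q) (hW : IsSpectralProcess W Q) :
    IsSpectralProcess W' ρ := by
  have hs (s : S) : IdentDistrib (W' s) (W s) ρ Q :=
    h.copy.comp (u := fun w : S → ℝ => w s) (measurable_pi_apply s)
  exact ⟨h.measurable, fun s => (hs s).symm.ae_mem_snd measurableSet_Ici (hW.nonneg s),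
    fun s => (hs s).integral_eq.trans (hW.mean_one s)⟩

/-- A spectral process stays one after multiplication by independent nonnegative multipliers
of mean one. -/
lemma IsIndepCopy.spectral_mul (h : IsIndepCopy Z W' ρ W Q) (hW : IsSpectralProcess W Q)
    {m : ℝ → ℝ} (hm : Measurable m) (hZ : ∀ s, Measurable (Z s))
    (hZ0 : ∀ s, ∀ᵐ ω ∂ρ, 0 ≤ m (Z s ω)) (hZ1 : ∀ s, ∫ ω, m (Z s ω) ∂ρ = 1) :
    IsSpectralProcess (fun s ω => m (Z s ω) * W' s ω) ρ := by
  have hW' := h.spectral hW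
  refine ⟨fun s => (hm.comp (hZ s)).mul (h.measurable s), fun s => ?_, fun s => ?_⟩
  · filter_upwards [hZ0 s, hW'.nonneg s] with ω h1 h2 using mul_nonneg h1 h2
  · have hind : IndepFun (fun ω => m (Z s ω)) (W' s) ρ :=
      h.indep.comp (φ := fun z : S → ℝ => m (z s)) (ψ := fun w : S → ℝ => w s)
        (hm.comp (measurable_pi_apply s)) (measurable_pi_apply s)
    rw [hind.integral_fun_mul_eq_mul_integral (hm.comp (hZ s)).aestronglyMeasurable
      (h.measurable s).aestronglyMeasurable, hZ1, hW'.mean_one, one_mul]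

end

/-! ### From `ℓ^p` to de Haan and `ℓ^q` representations -/

section

variable {S : Type u} {Ω : Type v} [MeasurableSpace Ω] {P : Measure Ω} {E : Type w}
  [MeasurableSpace E] {Q : Measure E} [IsProbabilityMeasure Q] {X : S → Ω → ℝ} {W : S → E → ℝ}
  {E' : Type z} [MeasurableSpace E'] {ρ : Measure E'} [IsProbabilityMeasure ρ]

lemma measurable_coe_path : Measurable fun (y : S → ℝ≥0∞) (s : S) => (y s : EReal) :=
  measurable_pi_iff.2 fun s => measurable_coe_ennreal_ereal.comp (measurable_pi_apply s)

/-- Fréchet noise moved from outside the `ℓ^p` norm onto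
the individual points turns the norm into a maximum. -/
theorem HasLpRepresentation.hasDeHaanRepresentation {p : ℝ≥0∞} (hp1 : 1 < p) (hp : p < ∞)
    (hX : HasLpRepresentation p X P W Q) {U W' : S → E' → ℝ} (hU : IsFrechetNoise p U ρ)
    (hW' : IsIndepCopy U W' ρ W Q) :
    HasDeHaanRepresentation X P (fun s ω => U s ω / gammaConst p * W' s ω) ρ := by
  obtain ⟨hW, Ω₁, _, P₁, U₁, A₁, W₁, _, hU₁, hA₁, hW₁, hAW₁, hUAW₁, hXid⟩ := hX
  have hc := gammaConst_pos hp1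
  have hV : IsSpectralProcess (fun s ω => U s ω / gammaConst p * W' s ω) ρ := by
    refine hW'.spectral_mul hW (m := fun u => u / gammaConst p) (by fun_prop)
      (fun s => (hU.frechet s).measurable) (fun s => ?_) fun s => ?_
    · filter_upwards [(hU.frechet s).ae_pos] with ω hω using (div_pos hω hc).le
    · rw [integral_div, (hU.frechet s).integral_eq hp1 hp, div_self hc.ne']
  obtain ⟨Ω₂, _, P₂, -, A₂, V₂, _, -, -, -, hA₂, hmapA, hV₂, hAV₂, -⟩ :=
    exists_independent_families (P := P₁) (Q := ρ) hA₁ hV.measurable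
      (ν := fun _ : S => frechetMeasure p.toReal)
  refine ⟨hV, Ω₂, inferInstance, P₂, A₂, V₂, ‹_›, hA₂, hV₂, hAV₂, hXid.trans ?_⟩
  have hm₁ := measurable_lpProcess p (fun s => (hU₁.frechet s).measurable) hA₁.measurable
    hW₁.measurable
  have hm₂ : Measurable fun ω s => ⨆ i, ENNReal.ofReal (A₂ i ω * V₂ i s ω) :=
    measurable_pi_iff.2 fun s => Measurable.iSup fun i =>
      ((hA₂.measurable i).mul (hV₂.measurable i s)).ennreal_ofReal
  refine IdentDistrib.comp (u := fun (y : S → ℝ≥0∞) (s : S) => (y s : EReal))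
    ⟨hm₁.aemeasurable, hm₂.aemeasurable, map_eq_of_measure_le hm₁ hm₂ fun F x hx => ?_⟩
    measurable_coe_path
  rw [measure_lpRepresentation_le hp1 hp hU₁ hA₁.measurable hW.measurable hW₁ hAW₁ hUAW₁ F hx,
    measure_deHaanRepresentation_le hA₂.measurable hV.measurable hV₂ hAV₂ F x, hmapA]
  simp only [measure_frechet_mul_le hp1 hp hU hW' F hx]

/-- Stable multipliers on the individual points compensate the passage from the exponent `p` to
`q` in both the noise and the norm. -/
theorem HasLpRepresentation.hasLpRepresentation_of_lt {p q : ℝ≥0∞} (hp1 : 1 < p) (hpq : p < q)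
    (hq : q < ∞) (hX : HasLpRepresentation p X P W Q) {T W' : S → E' → ℝ}
    (hT : IsStableNoise (p.toReal / q.toReal) T ρ) (hW' : IsIndepCopy T W' ρ W Q) :
    HasLpRepresentation q X P
      (fun s ω => gammaConst q / gammaConst p * T s ω ^ (1 / q.toReal) * W' s ω) ρ := by
  obtain ⟨hW, Ω₁, _, P₁, U₁, A₁, W₁, _, hU₁, hA₁, hW₁, hAW₁, hUAW₁, hXid⟩ := hX
  have hp : p < ∞ := hpq.trans hq
  have hq1 : 1 < q := hp1.trans hpq
  have hcp := gammaConst_pos hp1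
  have hcq := gammaConst_pos hq1
  have hV : IsSpectralProcess
      (fun s ω => gammaConst q / gammaConst p * T s ω ^ (1 / q.toReal) * W' s ω) ρ := by
    refine hW'.spectral_mul hW (m := fun t => gammaConst q / gammaConst p *
      t ^ (1 / q.toReal)) (by fun_prop) hT.measurable (fun s => ?_) fun s => ?_
    · filter_upwards [hT.nonneg s] with ω hω
      positivity
    · have hTm := hT.measurable s
      rw [integral_const_mul, integral_eq_lintegral_of_nonneg_ae _
        (hTm.pow_const _).aestronglyMeasurable,
        hT.lintegral_rpow hp1 hpq hq, ENNReal.toReal_ofReal (by positivity)]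
      · field_simp
      · filter_upwards [hT.nonneg s] with ω hω
        exact Real.rpow_nonneg hω _
  obtain ⟨Ω₂, _, P₂, U₂, A₂, V₂, _, hU₂m, hU₂, hU₂i, hA₂, hmapA, hV₂, hAV₂, hUAV₂⟩ :=
    exists_independent_families (P := P₁) (Q := ρ) hA₁ hV.measurable
      (ν := fun _ : S => frechetMeasure q.toReal)
  have hU₂' : IsFrechetNoise q U₂ P₂ :=
    ⟨fun s => IsFrechet.of_map_eq hq1 hq (hU₂m s) (hU₂ s), hU₂i⟩
  refine ⟨hV, Ω₂, inferInstance, P₂, U₂, A₂, V₂, ‹_›, hU₂', hA₂, hV₂, hAV₂, hUAV₂,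
    hXid.trans ?_⟩
  have hm₁ := measurable_lpProcess p (fun s => (hU₁.frechet s).measurable) hA₁.measurable
    hW₁.measurable
  have hm₂ := measurable_lpProcess q hU₂m hA₂.measurable hV₂.measurable
  refine IdentDistrib.comp (u := fun (y : S → ℝ≥0∞) (s : S) => (y s : EReal))
    ⟨hm₁.aemeasurable, hm₂.aemeasurable, map_eq_of_measure_le hm₁ hm₂ fun F x hx => ?_⟩
    measurable_coe_path
  rw [measure_lpRepresentation_le hp1 hp hU₁ hA₁.measurable hW.measurable hW₁ hAW₁ hUAW₁ F hx,
    measure_lpRepresentation_le hq1 hq hU₂' hA₂.measurable hV.measurable hV₂ hAV₂ hUAV₂ F hx,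
    hmapA]
  have hpt (a : ℝ) := lintegral_stable_lpExponent hp1 hpq hq hT hW' F hx a
  simp only [← hpt]
  rfl

end

/-- A de Haan representation is an `ℓ^∞` representation: the `Φ_∞` noise is constant `1`. -/
lemma HasDeHaanRepresentation.hasLpRepresentation_top {S : Type u} {Ω : Type v}
    [MeasurableSpace Ω] {P : Measure Ω} {E : Type w} [MeasurableSpace E] {Q : Measure E}
    {X : S → Ω → ℝ} {V : S → E → ℝ} (h : HasDeHaanRepresentation X P V Q) :
    HasLpRepresentation ∞ X P V Q := by
  obtain ⟨hV, Ω₁, _, P₁, A, V', _, hA, hV', hAV, hX⟩ := h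
  refine ⟨hV, Ω₁, inferInstance, P₁, fun _ _ => 1, A, V', inferInstance, ⟨fun s =>
    ⟨measurable_const, fun x => ?_⟩, ?_⟩, hA, hV', hAV, indepFun_const_left _ _, ?_⟩
  · by_cases hx : 1 ≤ x <;> simp [frechetCDF, hx]
  · exact iIndepFun_iff_measure_inter_preimage_eq_mul.2 fun F B hB => by
      by_cases h1 : ∀ s ∈ F, (1 : ℝ) ∈ B s
      · have h2 : ∀ s ∈ F, (fun _ : Ω₁ => (1 : ℝ)) ⁻¹' B s = Set.univ := fun s hs => by
          ext; simp [h1 s hs]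
        rw [Set.iInter₂_congr h2, Finset.prod_congr rfl fun s hs => congrArg P₁ (h2 s hs)]
        simp
      · obtain ⟨s, hs, h1⟩ : ∃ s ∈ F, (1 : ℝ) ∉ B s := by simpa using h1
        have h2 : (fun _ : Ω₁ => (1 : ℝ)) ⁻¹' B s = ∅ := by ext; simp [h1]
        rw [Finset.prod_eq_zero hs (by rw [h2, measure_empty])]
        exact measure_mono_null (Set.iInter₂_subset s hs) (by rw [h2, measure_empty])
  · simpa [gammaConst, seqNorm] using hX

/-! ### The Laplace functional of the Poisson process -/

lemma tsum_expNeg_mul_poissonMeasure (m : ℝ≥0) (c : ℝ≥0) :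
    ∑' n : ℕ, expNeg (c * n) * poissonMeasure m {n} = expNeg (m * (1 - expNeg c)) := by
  have hexp : expNeg c = ENNReal.ofReal (Real.exp (-c)) := by
    rw [← expNeg_ofReal c.coe_nonneg, ENNReal.ofReal_coe_nnreal]
  have hle : Real.exp (-c) ≤ 1 := by simp
  have hterm (n : ℕ) : expNeg (c * n) * poissonMeasure m {n} =
      ENNReal.ofReal (Real.exp (-m) * ((m * Real.exp (-c)) ^ n / n.factorial)) := by
    have h1 : (c : ℝ≥0∞) * n = ENNReal.ofReal (c * n) := by
      rw [ENNReal.ofReal_mul c.coe_nonneg, ENNReal.ofReal_coe_nnreal, ENNReal.ofReal_natCast]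
    rw [h1, expNeg_ofReal (by positivity), poissonMeasure_singleton,
      ← ENNReal.ofReal_mul (by positivity)]
    congr 1
    rw [mul_pow, ← Real.exp_nat_mul, show (n : ℝ) * -c = -(c * n) by ring]
    ring
  have hsum : HasSum (fun n : ℕ => Real.exp (-m) * ((m * Real.exp (-c)) ^ n / n.factorial))
      (Real.exp (-m) * Real.exp (m * Real.exp (-c))) := by
    refine HasSum.mul_left _ ?_
    rw [Real.exp_eq_exp_ℝ]
    exact NormedSpace.expSeries_div_hasSum_exp _
  simp only [hterm]
  rw [← ENNReal.ofReal_tsum_of_nonneg (fun n => by positivity) hsum.summable, hsum.tsum_eq, hexp,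
    ← ENNReal.ofReal_one, ← ENNReal.ofReal_sub _ (Real.exp_pos _).le,
    ← ENNReal.ofReal_coe_nnreal (p := m), ← ENNReal.ofReal_mul m.coe_nonneg,
    expNeg_ofReal (mul_nonneg m.coe_nonneg (by linarith)), ← Real.exp_add]
  congr 2
  ring

namespace IsPoissonProcess

variable {Ω : Type v} [MeasurableSpace Ω] {P : Measure Ω} [IsProbabilityMeasure P]
  {A : ℕ → Ω → ℝ}

/-- The Laplace transform of a Poisson number of points. -/
lemma lintegral_expNeg_count (hA : IsPoissonProcess A P) {B : Set ℝ} (hB : MeasurableSet B)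
    (hBt : intensity B ≠ ∞) (c : ℝ≥0) :
    ∫⁻ ω, expNeg (c * pointProcess A ω B) ∂P = expNeg (intensity B * (1 - expNeg c)) := by
  have hN : Measurable fun ω => pointProcess A ω B := by
    simp only [pointProcess_apply _ _ hB]
    exact (measurable_countIn hB).comp (measurable_pi_iff.2 hA.measurable)
  have hsm (n : ℕ) : MeasurableSet {ω | pointProcess A ω B = n} := hN (measurableSet_singleton _)
  have hdisj : Pairwise (Function.onFun Disjoint fun n : ℕ => {ω | pointProcess A ω B = n}) := by
    intro m n hmn
    refine Set.disjoint_left.2 fun ω h1 h2 => hmn ?_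
    exact_mod_cast (h1 : pointProcess A ω B = m).symm.trans h2
  have hp := hA.poisson B hB hBt
  have hone : P (⋃ n : ℕ, {ω | pointProcess A ω B = n}) = 1 := by
    rw [measure_iUnion hdisj hsm, tsum_congr hp]
    simpa using tsum_expNeg_mul_poissonMeasure (intensity B).toNNReal 0
  have hae : (⋃ n : ℕ, {ω | pointProcess A ω B = n}) =ᵐ[P] Set.univ :=
    eventuallyEq_univ.2 ((prob_compl_eq_zero_iff (MeasurableSet.iUnion hsm)).2 hone)
  have hsplit := lintegral_iUnion hsm hdisj (μ := P) fun ω => expNeg (c * pointProcess A ω B)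
  rw [setLIntegral_congr hae, setLIntegral_univ] at hsplit
  rw [hsplit]
  conv_rhs => rw [← ENNReal.coe_toNNReal hBt]
  rw [← tsum_expNeg_mul_poissonMeasure]
  refine tsum_congr fun n => ?_
  rw [setLIntegral_congr_fun (g := fun _ => expNeg (c * n)) (hsm n), setLIntegral_const, hp]
  intro ω hω
  have : pointProcess A ω B = n := hω
  simp only [this]

/-- The Laplace functional on simple functions, from the independence of the numbers of points in
the level sets. -/
lemma lintegral_expNeg_simpleFunc (hA : IsPoissonProcess A P) (g : SimpleFunc ℝ ℝ≥0∞)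
    (hg : ∀ a, g a ≠ ∞) (hg0 : intensity (Function.support g) ≠ ∞) :
    ∫⁻ ω, expNeg (∑' i, g (A i ω)) ∂P = expNeg (∫⁻ a, (1 - expNeg (g a)) ∂intensity) := by
  classical
  -- The level sets of `g`, except the set where `g = 0`, whose intensity may be infinite.
  let R : Finset ℝ≥0∞ := g.range.filter (· ≠ 0)
  let e : Fin R.card ≃ R := R.equivFin.symm
  let B : Fin R.card → Set ℝ := fun j => g ⁻¹' {(e j : ℝ≥0∞)}
  have hB (j : Fin R.card) : MeasurableSet (B j) := g.measurableSet_preimage _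
  have hR (j : Fin R.card) : (e j : ℝ≥0∞) ∈ g.range ∧ (e j : ℝ≥0∞) ≠ 0 :=
    Finset.mem_filter.1 (e j).2
  have hBd : Pairwise (Function.onFun Disjoint B) := fun i j hij =>
    Disjoint.preimage _ (Set.disjoint_singleton.2 fun h => hij (e.injective (Subtype.ext h)))
  have hBt (j : Fin R.card) : intensity (B j) ≠ ∞ := by
    refine ne_top_of_le_ne_top hg0 (measure_mono fun a ha => ?_)
    have : g a = e j := ha
    rw [Function.mem_support, this]
    exact (hR j).2
  have het (j : Fin R.card) : (e j : ℝ≥0∞) ≠ ∞ := by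
    obtain ⟨a, ha⟩ := SimpleFunc.mem_range.1 (hR j).1
    rw [← ha]
    exact hg a
  have hsum (F : ℝ≥0∞ → ℝ≥0∞) (hF : F 0 = 0) :
      ∑ y ∈ g.range, F y = ∑ j, F (e j) := by
    rw [e.sum_comp fun y : R => F y, Finset.sum_coe_sort R F]
    refine (Finset.sum_filter_of_ne (p := (· ≠ 0)) fun y _ hy h0 => hy ?_).symm
    rw [h0, hF]
  have hleft (ω : Ω) : ∑' i, g (A i ω) = ∑ j, (e j : ℝ≥0∞) * pointProcess A ω (B j) := by
    have h1 : ∑' i, g (A i ω) = ∫⁻ a, g a ∂(pointProcess A ω) := by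
      rw [pointProcess, lintegral_sum_measure]
      simp only [lintegral_dirac]
    rw [h1, SimpleFunc.lintegral_eq_lintegral, SimpleFunc.lintegral]
    exact hsum (fun y => y * pointProcess A ω (g ⁻¹' {y})) (zero_mul _)
  have hright : ∫⁻ a, (1 - expNeg (g a)) ∂intensity =
      ∑ j, (1 - expNeg (e j)) * intensity (B j) := by
    have h1 := (g.map fun y => 1 - expNeg y).lintegral_eq_lintegral intensity
    rw [SimpleFunc.map_lintegral] at h1
    rw [← hsum (fun y => (1 - expNeg y) * intensity (g ⁻¹' {y})) (by simp)]
    exact h1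
  have hN (j : Fin R.card) : Measurable fun ω => pointProcess A ω (B j) := by
    simp only [pointProcess_apply _ _ (hB j)]
    exact (measurable_countIn (hB j)).comp (measurable_pi_iff.2 hA.measurable)
  simp only [hleft, hright, expNeg_sum]
  rw [iIndepFun.lintegral_finset_prod hN (hA.indep _ B hB hBd) Finset.univ
    (g := fun j n => expNeg (e j * n)) (fun j => by fun_prop)]
  refine Finset.prod_congr rfl fun j _ => ?_
  have := hA.lintegral_expNeg_count (hB j) (hBt j) (e j : ℝ≥0∞).toNNReal
  rwa [ENNReal.coe_toNNReal (het j), mul_comm (intensity (B j))] at this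

end IsPoissonProcess

lemma lintegral_intensity {f : ℝ → ℝ≥0∞} (hf : Measurable f) :
    ∫⁻ a, f a ∂intensity = ∫⁻ a in Set.Ioi 0, ENNReal.ofReal ((a ^ 2)⁻¹) * f a := by
  rw [intensity, lintegral_withDensity_eq_lintegral_mul _ (by fun_prop) hf]
  rfl

lemma intensity_Ici_ne_top {r : ℝ} (hr : 0 < r) : intensity (Set.Ici r) ≠ ∞ := by
  rw [intensity, withDensity_apply _ measurableSet_Ici, Measure.restrict_restrict measurableSet_Ici,
    Set.inter_eq_left.2 (Set.Ici_subset_Ioi.2 hr), setLIntegral_congr Ioi_ae_eq_Ici.symm]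
  have h := (integrableOn_Ioi_rpow_of_lt (a := -2) (by norm_num) hr).lintegral_lt_top
  refine ne_of_lt (lt_of_le_of_lt (le_of_eq ?_) h)
  refine setLIntegral_congr_fun measurableSet_Ioi fun a ha => ?_
  have ha0 : 0 < a := hr.trans ha
  rw [Real.rpow_neg ha0.le]
  norm_num

lemma ae_intensity_pos : ∀ᵐ a ∂intensity, 0 < a :=
  (withDensity_absolutelyContinuous _ _).ae_le (ae_restrict_mem measurableSet_Ioi)

/-- The Laplace functional of the Poisson process. -/
lemma IsPoissonProcess.lintegral_expNeg_tsum {Ω : Type v} [MeasurableSpace Ω] {P : Measure Ω}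
    [IsProbabilityMeasure P] {A : ℕ → Ω → ℝ} (hA : IsPoissonProcess A P) {f : ℝ → ℝ≥0∞}
    (hf : Measurable f) :
    ∫⁻ ω, expNeg (∑' i, f (A i ω)) ∂P = expNeg (∫⁻ a, (1 - expNeg (f a)) ∂intensity) := by
  -- Simple functions supported in `[1 / (n + 1), ∞)` that increase to `f` on `(0, ∞)`.
  let g : ℕ → SimpleFunc ℝ ℝ≥0∞ := fun n =>
    (SimpleFunc.eapprox f n).restrict (Set.Ici (1 / ((n : ℝ) + 1)))
  have hr (n : ℕ) : 0 < 1 / ((n : ℝ) + 1) := by positivity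
  have hg_apply (n : ℕ) (a : ℝ) :
      g n a = (Set.Ici (1 / ((n : ℝ) + 1))).indicator (SimpleFunc.eapprox f n) a :=
    SimpleFunc.restrict_apply _ measurableSet_Ici a
  have hmono (a : ℝ) : Monotone fun n => g n a := by
    intro m n hmn
    simp only [hg_apply]
    refine (Set.indicator_le_indicator (SimpleFunc.monotone_eapprox f hmn a)).trans
      (Set.indicator_le_indicator_of_subset (Set.Ici_subset_Ici.2 ?_) (fun _ => zero_le) a)
    have : (m : ℝ) ≤ n := by exact_mod_cast hmn
    gcongr
  have hlim (a : ℝ) (ha : 0 < a) : Tendsto (fun n => g n a) atTop (𝓝 (f a)) := by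
    have h1 : Tendsto (fun n => SimpleFunc.eapprox f n a) atTop (𝓝 (f a)) := by
      rw [← SimpleFunc.iSup_eapprox_apply hf a]
      exact tendsto_atTop_iSup fun m n h => SimpleFunc.monotone_eapprox f h a
    refine h1.congr' ?_
    have h2 := (tendsto_one_div_add_atTop_nhds_zero_nat (𝕜 := ℝ)).eventually_le_const ha
    filter_upwards [h2] with n hn
    rw [hg_apply, Set.indicator_of_mem (Set.mem_Ici.2 hn)]
  have heq (n : ℕ) := hA.lintegral_expNeg_simpleFunc (g n)
    (fun a => by
      rw [hg_apply]
      refine ne_top_of_le_ne_top (SimpleFunc.eapprox_lt_top f n a).ne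
        (Set.indicator_le_self _ _ a))
    (ne_top_of_le_ne_top (intensity_Ici_ne_top (hr n)) (measure_mono fun a ha => by
      by_contra h
      exact ha (by rw [hg_apply, Set.indicator_of_notMem h])))
  have hleft : Tendsto (fun n => ∫⁻ ω, expNeg (∑' i, g n (A i ω)) ∂P) atTop
      (𝓝 (∫⁻ ω, expNeg (∑' i, f (A i ω)) ∂P)) := by
    refine tendsto_lintegral_of_dominated_convergence (fun _ => 1) (fun n => ?_) (fun n => ?_)
      (by simp) ?_
    · exact measurable_expNeg.comp (Measurable.tsum fun i =>
        (g n).measurable.comp (hA.measurable i))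
    · exact ae_of_all _ fun ω => expNeg_le_one _
    · filter_upwards [hA.pos] with ω hω
      refine (continuous_expNeg.tendsto _).comp ?_
      simp only [← lintegral_count]
      exact lintegral_tendsto_of_tendsto_of_monotone
        (fun n => (measurable_of_countable _).aemeasurable)
        (ae_of_all _ fun i => hmono _) (ae_of_all _ fun i => hlim _ (hω i))
  have hright : Tendsto (fun n => expNeg (∫⁻ a, (1 - expNeg (g n a)) ∂intensity)) atTop
      (𝓝 (expNeg (∫⁻ a, (1 - expNeg (f a)) ∂intensity))) := by
    refine (continuous_expNeg.tendsto _).comp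
      (lintegral_tendsto_of_tendsto_of_monotone (fun n => ?_) ?_ ?_)
    · exact (measurable_const.sub (measurable_expNeg.comp (g n).measurable)).aemeasurable
    · exact ae_of_all _ fun a m n h => tsub_le_tsub_left (expNeg_antitone (hmono a h)) 1
    · filter_upwards [ae_intensity_pos] with a ha
      exact ENNReal.Tendsto.sub tendsto_const_nhds
        ((continuous_expNeg.tendsto _).comp (hlim a ha)) (Or.inl ENNReal.one_ne_top)
  simp only [heq] at hleft
  exact tendsto_nhds_unique hleft hright

/-! ### Positive stable laws from the Poisson process -/

lemma one_sub_expNeg_le (y : ℝ≥0∞) : 1 - expNeg y ≤ y := by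
  rcases eq_or_ne y ∞ with rfl | hy
  · simp
  lift y to ℝ≥0 using hy
  rw [← ENNReal.ofReal_coe_nnreal (p := y), expNeg_ofReal y.coe_nonneg, ← ENNReal.ofReal_one,
    ← ENNReal.ofReal_sub _ (Real.exp_pos _).le]
  refine ENNReal.ofReal_le_ofReal ?_
  linarith [Real.add_one_le_exp (-(y : ℝ))]

/-- The measure `a⁻² da` scales like `s` under `a ↦ a / s`. -/
lemma lintegral_intensity_comp_mul {s : ℝ} (hs : 0 < s) {f : ℝ → ℝ≥0∞} (hf : Measurable f) :
    ∫⁻ a, f (s * a) ∂intensity = ENNReal.ofReal s * ∫⁻ a, f a ∂intensity := by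
  let G : ℝ → ℝ≥0∞ := (Set.Ioi 0).indicator fun a => ENNReal.ofReal ((a ^ 2)⁻¹) * f a
  have hG : Measurable G := Measurable.indicator (by fun_prop) measurableSet_Ioi
  have h1 : ∫⁻ a, f (s * a) ∂intensity = ∫⁻ a, ENNReal.ofReal (s ^ 2) * G (s * a) := by
    rw [lintegral_intensity (f := fun a => f (s * a)) (by fun_prop),
      ← lintegral_indicator measurableSet_Ioi]
    refine lintegral_congr fun a => ?_
    by_cases ha : 0 < a
    · have hsa : 0 < s * a := mul_pos hs ha
      simp only [G, Set.indicator_of_mem (Set.mem_Ioi.2 ha),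
        Set.indicator_of_mem (Set.mem_Ioi.2 hsa)]
      rw [← mul_assoc, ← ENNReal.ofReal_mul (by positivity)]
      congr 2
      field_simp
    · have hsa : ¬ 0 < s * a := fun h => ha (pos_of_mul_pos_right h hs.le)
      simp only [G, Set.indicator_of_notMem (show a ∉ Set.Ioi 0 from ha),
        Set.indicator_of_notMem (show s * a ∉ Set.Ioi 0 from hsa), mul_zero]
  rw [h1, lintegral_const_mul (f := fun a => G (s * a)) _ (hG.comp (by fun_prop)),
    ← lintegral_map (f := G) (g := fun a => s * a) hG (by fun_prop),
    Real.map_volume_mul_left hs.ne',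
    lintegral_smul_measure, lintegral_intensity hf, ← lintegral_indicator measurableSet_Ioi,
    smul_eq_mul, ← mul_assoc, ← ENNReal.ofReal_mul (by positivity), abs_of_pos (inv_pos.2 hs)]
  congr 2
  field_simp

/-- The constant `∫ (1 - exp (-a ^ k)) a⁻² da`, an integral over `(0, ∞)`. Its `k`-th power is the
scale of `∑ᵢ Aᵢ ^ k` relative to the standard positive `1/k`-stable law. -/
noncomputable def stableConst (k : ℝ) : ℝ≥0∞ :=
  ∫⁻ a, (1 - expNeg (ENNReal.ofReal a ^ k)) ∂intensity

lemma measurable_one_sub_expNeg_rpow (k : ℝ) :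
    Measurable fun a : ℝ => 1 - expNeg (ENNReal.ofReal a ^ k) := by
  fun_prop

lemma stableConst_ne_top {k : ℝ} (hk : 1 < k) : stableConst k ≠ ∞ := by
  rw [stableConst, lintegral_intensity (measurable_one_sub_expNeg_rpow k),
    ← Set.Ioc_union_Ioi_eq_Ioi zero_le_one,
    lintegral_union measurableSet_Ioi (Set.Ioc_disjoint_Ioi le_rfl)]
  refine ENNReal.add_ne_top.2 ⟨ne_of_lt ?_, ne_of_lt ?_⟩
  · -- Near `0` the integrand is at most `a ^ (k - 2)`, and `k - 2 > -1`.
    have h : IntegrableOn (fun a : ℝ => a ^ (k - 2)) (Set.Ioc 0 1) :=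
      (intervalIntegrable_iff_integrableOn_Ioc_of_le zero_le_one).1
        (intervalIntegral.intervalIntegrable_rpow' (by linarith))
    refine lt_of_le_of_lt (setLIntegral_mono' measurableSet_Ioc fun a ha => ?_) h.lintegral_lt_top
    refine (mul_le_mul_right (one_sub_expNeg_le _) _).trans (le_of_eq ?_)
    rw [ENNReal.ofReal_rpow_of_pos ha.1, ← ENNReal.ofReal_mul (by positivity),
      Real.rpow_sub ha.1, Real.rpow_two, div_eq_inv_mul]
  · have h := integrableOn_Ioi_rpow_of_lt (a := -2) (by norm_num) one_pos
    refine lt_of_le_of_lt (setLIntegral_mono' measurableSet_Ioi fun a ha => ?_) h.lintegral_lt_top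
    have ha0 : (0 : ℝ) < a := one_pos.trans ha
    refine (mul_le_mul_right (tsub_le_self (a := 1)) _).trans (le_of_eq ?_)
    rw [mul_one, Real.rpow_neg ha0.le, Real.rpow_two]

lemma stableConst_ne_zero (k : ℝ) : stableConst k ≠ 0 := by
  rw [stableConst, lintegral_intensity (measurable_one_sub_expNeg_rpow k)]
  refine (setLIntegral_pos_iff (by fun_prop)).2 ?_ |>.ne'
  have : Set.Ioi (0 : ℝ) ⊆ Function.support
      (fun a : ℝ => ENNReal.ofReal ((a ^ 2)⁻¹) * (1 - expNeg (ENNReal.ofReal a ^ k))) := by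
    intro a ha
    have ha0 : (0 : ℝ) < a := ha
    refine mul_ne_zero (by simpa using by positivity) (tsub_pos_of_lt ?_).ne'
    rw [ENNReal.ofReal_rpow_of_pos ha0, expNeg_ofReal (by positivity), ENNReal.ofReal_lt_one,
      Real.exp_lt_one_iff]
    exact neg_neg_of_pos (by positivity)
  rw [Set.inter_eq_right.2 this]
  simp

/-- A Poisson process `(Aᵢ)` with intensity `a⁻² da` yields a positive `α`-stable variable, a
multiple of `∑ᵢ Aᵢ ^ (1/α)`. -/
lemma IsPoissonProcess.exists_stable {Ω : Type v} [MeasurableSpace Ω] {P : Measure Ω}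
    [IsProbabilityMeasure P] {A : ℕ → Ω → ℝ} (hA : IsPoissonProcess A P) {α : ℝ} (hα0 : 0 < α)
    (hα1 : α < 1) :
    ∃ T : Ω → ℝ, Measurable T ∧ (∀ ω, 0 ≤ T ω) ∧
      ∀ t : ℝ, 0 ≤ t → ∫ ω, Real.exp (-(t * T ω)) ∂P = Real.exp (-t ^ α) := by
  let k : ℝ := α⁻¹
  have hk : 1 < k := (one_lt_inv₀ hα0).2 hα1
  have hk0 : 0 < k := one_pos.trans hk
  let κ : ℝ := (stableConst k).toReal
  have hκ : 0 < κ := ENNReal.toReal_pos (stableConst_ne_zero k) (stableConst_ne_top hk)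
  have hκ' : stableConst k = ENNReal.ofReal κ :=
    (ENNReal.ofReal_toReal (stableConst_ne_top hk)).symm
  -- The scaling by `κ⁻¹` normalises the Laplace transform to `exp (-t ^ α)`.
  let Z : Ω → ℝ≥0∞ := fun ω => ∑' i, ENNReal.ofReal (κ⁻¹ * A i ω) ^ k
  have hZm : Measurable Z := Measurable.tsum fun i =>
    ((hA.measurable i).const_mul _).ennreal_ofReal.pow_const _
  have hlap (t : ℝ) (ht : 0 < t) :
      ∫⁻ ω, expNeg (ENNReal.ofReal t * Z ω) ∂P = expNeg (ENNReal.ofReal (t ^ α)) := by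
    have hs : 0 < t ^ α * κ⁻¹ := by positivity
    have h1 (a : ℝ) : ENNReal.ofReal t * ENNReal.ofReal (κ⁻¹ * a) ^ k =
        ENNReal.ofReal (t ^ α * κ⁻¹ * a) ^ k := by
      have : ENNReal.ofReal t = ENNReal.ofReal (t ^ α) ^ k := by
        rw [ENNReal.ofReal_rpow_of_pos (by positivity), ← Real.rpow_mul ht.le,
          mul_inv_cancel₀ hα0.ne', Real.rpow_one]
      rw [this, ← ENNReal.mul_rpow_of_nonneg _ _ hk0.le, ← ENNReal.ofReal_mul (by positivity),
        mul_assoc]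
    simp only [Z, ← ENNReal.tsum_mul_left, h1]
    rw [hA.lintegral_expNeg_tsum (f := fun a => ENNReal.ofReal (t ^ α * κ⁻¹ * a) ^ k)
      (by fun_prop), lintegral_intensity_comp_mul hs (measurable_one_sub_expNeg_rpow k)]
    change expNeg (_ * stableConst k) = _
    rw [hκ', ← ENNReal.ofReal_mul hs.le, inv_mul_cancel_right₀ hκ.ne']
  -- Letting `t → 0` in the Laplace transform shows that `Z` is almost surely finite.
  have hfin : ∀ᵐ ω ∂P, Z ω ≠ ∞ := by
    have hms : MeasurableSet {ω | Z ω = ∞}ᶜ := (hZm (measurableSet_singleton ∞)).compl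
    have hle (n : ℕ) : expNeg (ENNReal.ofReal ((1 / ((n : ℝ) + 1)) ^ α)) ≤ P {ω | Z ω = ∞}ᶜ := by
      rw [← hlap _ (by positivity), ← lintegral_indicator_one hms]
      refine lintegral_mono fun ω => ?_
      by_cases h : Z ω = ∞
      · have hn : ENNReal.ofReal (1 / ((n : ℝ) + 1)) ≠ 0 := by
          simpa using by positivity
        rw [h, ENNReal.mul_top hn, expNeg_top]
        exact zero_le
      · simpa [h] using expNeg_le_one _
    have hlim : Tendsto (fun n : ℕ => expNeg (ENNReal.ofReal ((1 / ((n : ℝ) + 1)) ^ α))) atTop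
        (𝓝 1) := by
      have h0 : expNeg (ENNReal.ofReal ((0 : ℝ) ^ α)) = 1 := by simp [Real.zero_rpow hα0.ne']
      rw [← h0]
      refine (continuous_expNeg.tendsto _).comp ((ENNReal.continuous_ofReal.tendsto _).comp ?_)
      exact ((Real.continuousAt_rpow_const 0 α (Or.inr hα0.le)).tendsto).comp
        tendsto_one_div_add_atTop_nhds_zero_nat
    have h1 : P {ω | Z ω = ∞}ᶜ = 1 := le_antisymm prob_le_one (le_of_tendsto' hlim hle)
    exact (prob_compl_eq_zero_iff hms).2 h1
  refine ⟨fun ω => (Z ω).toReal, hZm.ennreal_toReal, fun ω => ENNReal.toReal_nonneg, fun t ht => ?_⟩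
  rcases ht.eq_or_lt with rfl | ht
  · simp [Real.zero_rpow hα0.ne']
  have hm : AEStronglyMeasurable (fun ω => Real.exp (-(t * (Z ω).toReal))) P :=
    (hZm.ennreal_toReal.const_mul t).neg.exp.aestronglyMeasurable
  rw [integral_eq_lintegral_of_nonneg_ae (ae_of_all _ fun ω => (Real.exp_pos _).le) hm]
  have h1 : ∫⁻ ω, ENNReal.ofReal (Real.exp (-(t * (Z ω).toReal))) ∂P =
      ∫⁻ ω, expNeg (ENNReal.ofReal t * Z ω) ∂P := by
    refine lintegral_congr_ae ?_
    filter_upwards [hfin] with ω hω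
    rw [← expNeg_ofReal (by positivity), ENNReal.ofReal_mul ht.le, ENNReal.ofReal_toReal hω]
  rw [h1, hlap t ht, expNeg_ofReal (by positivity), ENNReal.toReal_ofReal (Real.exp_pos _).le]

/-! ### Existence of the noises and inclusion of the classes -/

section

variable {S : Type u} {E : Type w} [MeasurableSpace E] {Q : Measure E} [IsProbabilityMeasure Q]
  {W : S → E → ℝ}

lemma exists_frechetNoise_indepCopy {p : ℝ≥0∞} (hp1 : 1 < p) (hp : p < ∞)
    (hW : ∀ s, Measurable (W s)) :
    ∃ (E' : Type u) (_ : MeasurableSpace E') (R : Measure E') (U W' : S → E' → ℝ),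
      IsProbabilityMeasure R ∧ IsFrechetNoise p U R ∧ IsIndepCopy U W' R W Q := by
  obtain ⟨E', _, R, U, W', hR, hUm, hU, hUi, hW'⟩ :=
    exists_independent_copy (Q := Q) hW (ν := fun _ => frechetMeasure p.toReal)
  exact ⟨E', _, R, U, W', hR, ⟨fun s => IsFrechet.of_map_eq hp1 hp (hUm s) (hU s), hUi⟩, hW'⟩

lemma exists_stableNoise_indepCopy {Ω : Type v} [MeasurableSpace Ω] {P : Measure Ω}
    [IsProbabilityMeasure P] {A : ℕ → Ω → ℝ} (hA : IsPoissonProcess A P) {α : ℝ} (hα0 : 0 < α)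
    (hα1 : α < 1) (hW : ∀ s, Measurable (W s)) :
    ∃ (E' : Type u) (_ : MeasurableSpace E') (R : Measure E') (T W' : S → E' → ℝ),
      IsProbabilityMeasure R ∧ IsStableNoise α T R ∧ IsIndepCopy T W' R W Q := by
  obtain ⟨τ, hτm, hτ0, hτ⟩ := hA.exists_stable hα0 hα1
  have := Measure.isProbabilityMeasure_map (μ := P) hτm.aemeasurable
  obtain ⟨E', _, R, T, W', hR, hTm, hT, hTi, hW'⟩ :=
    exists_independent_copy (Q := Q) hW (ν := fun _ => P.map τ)
  have hid (s : S) : IdentDistrib τ (T s) P R :=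
    ⟨hτm.aemeasurable, (hTm s).aemeasurable, (hT s).symm⟩
  refine ⟨E', _, R, T, W', hR, ⟨hTm, fun s => ?_, fun s t ht => ?_, hTi⟩, hW'⟩
  · exact (hid s).ae_mem_snd measurableSet_Ici (ae_of_all _ hτ0)
  · rw [← hτ t ht]
    exact ((hid s).comp (u := fun x => Real.exp (-(t * x))) (by fun_prop)).integral_eq.symm

end

lemma toReal_div_mem_Ioo {p q : ℝ≥0∞} (hp1 : 1 < p) (hpq : p < q) (hq : q < ∞) :
    0 < p.toReal / q.toReal ∧ p.toReal / q.toReal < 1 := by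
  have hp : 0 < p.toReal := ENNReal.toReal_pos (zero_lt_one.trans hp1).ne' (hpq.trans hq).ne
  have h := (ENNReal.toReal_lt_toReal (hpq.trans hq).ne hq.ne).2 hpq
  exact ⟨div_pos hp (hp.trans h), (div_lt_one (hp.trans h)).2 h⟩

lemma HasLpRepresentation.exists_stableNoise {S : Type u} {Ω : Type v} [MeasurableSpace Ω]
    {P : Measure Ω} {E : Type w} [MeasurableSpace E] {Q : Measure E} [IsProbabilityMeasure Q]
    {X : S → Ω → ℝ} {W : S → E → ℝ} {p q : ℝ≥0∞} (hX : HasLpRepresentation p X P W Q)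
    (hp1 : 1 < p) (hpq : p < q) (hq : q < ∞) :
    ∃ (E' : Type u) (_ : MeasurableSpace E') (R : Measure E') (T W' : S → E' → ℝ),
      IsProbabilityMeasure R ∧ IsStableNoise (p.toReal / q.toReal) T R ∧
        IsIndepCopy T W' R W Q := by
  obtain ⟨hW, Ω₁, _, P₁, U₁, A₁, W₁, _, hU₁, hA₁, -⟩ := hX
  obtain ⟨h0, h1⟩ := toReal_div_mem_Ioo hp1 hpq hq
  exact exists_stableNoise_indepCopy hA₁ h0 h1 hW.measurable

lemma MS_subset_of_lt {S : Type u} {Ω : Type v} [MeasurableSpace Ω] (P : Measure Ω) {p q : ℝ≥0∞}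
    (hp1 : 1 < p) (hpq : p < q) (hq : q < ∞) : MS S P p ⊆ MS S P q := by
  rintro X ⟨hX, E, _, Q, W, _, hXW⟩
  obtain ⟨E', _, R, T, W', hR, hT, hW'⟩ := hXW.exists_stableNoise hp1 hpq hq
  exact ⟨hX, E', _, R, _, hR, hXW.hasLpRepresentation_of_lt hp1 hpq hq hT hW'⟩

lemma MS_subset_top {S : Type u} {Ω : Type v} [MeasurableSpace Ω] (P : Measure Ω) {p : ℝ≥0∞}
    (hp1 : 1 < p) (hp : p < ∞) : MS S P p ⊆ MS S P ∞ := by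
  rintro X ⟨hX, E, _, Q, W, _, hXW⟩
  obtain ⟨E', _, R, U, W', hR, hU, hW'⟩ :=
    exists_frechetNoise_indepCopy (Q := Q) hp1 hp hXW.1.measurable
  exact ⟨hX, E', _, R, _, hR,
    (hXW.hasDeHaanRepresentation hp1 hp hU hW').hasLpRepresentation_top⟩

end MaxStable

theorem mainTheorem3 {S : Type u} [Countable S]
    {Ω : Type v} [MeasurableSpace Ω] (P : Measure Ω) [IsProbabilityMeasure P]
    (p : ℝ≥0∞) (hp1 : 1 < p) (hp : p < ∞) :
    (∀ (E : Type w) [MeasurableSpace E] (Q : Measure E) [IsProbabilityMeasure Q]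
      (X : S → Ω → ℝ) (W : S → E → ℝ), HasLpRepresentation p X P W Q →
      -- part 1: the de Haan representation with spectral process `U W / Γ(1 - 1/p)`
      ((∃ (E' : Type u) (_ : MeasurableSpace E') (R : Measure E') (U W' : S → E' → ℝ),
          IsProbabilityMeasure R ∧ IsFrechetNoise p U R ∧ IsIndepCopy U W' R W Q) ∧
        ∀ (E' : Type z) [MeasurableSpace E'] (R : Measure E') [IsProbabilityMeasure R]
          (U W' : S → E' → ℝ), IsFrechetNoise p U R → IsIndepCopy U W' R W Q →
          HasDeHaanRepresentation X P
            (fun s ω => U s ω / Real.Gamma (1 - 1 / p.toReal) * W' s ω) R) ∧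
      -- part 2: the `ℓ^q` representation with the stable multiplier
      (∀ q : ℝ≥0∞, p < q → q < ∞ →
        (∃ (E' : Type u) (_ : MeasurableSpace E') (R : Measure E') (T W' : S → E' → ℝ),
          IsProbabilityMeasure R ∧ IsStableNoise (p.toReal / q.toReal) T R ∧
            IsIndepCopy T W' R W Q) ∧
        ∀ (E' : Type z) [MeasurableSpace E'] (R : Measure E') [IsProbabilityMeasure R]
          (T W' : S → E' → ℝ), IsStableNoise (p.toReal / q.toReal) T R →
          IsIndepCopy T W' R W Q →
          HasLpRepresentation q X P
            (fun s ω => Real.Gamma (1 - 1 / q.toReal) / Real.Gamma (1 - 1 / p.toReal) *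
              T s ω ^ (1 / q.toReal) * W' s ω) R)) ∧
    -- the resulting inclusions of classes
    (∀ q : ℝ≥0∞, p < q → q < ∞ → MS S P p ⊆ MS S P q ∧ MS S P q ⊆ MS S P ∞) := by
  refine ⟨fun E _ Q _ X W hX => ⟨⟨?_, fun E' _ R _ U W' hU hW' => ?_⟩, fun q hpq hq =>
    ⟨?_, fun E' _ R _ T W' hT hW' => ?_⟩⟩, fun q hpq hq =>
    ⟨MS_subset_of_lt P hp1 hpq hq, MS_subset_top P (hp1.trans hpq) hq⟩⟩
  · exact exists_frechetNoise_indepCopy hp1 hp hX.1.measurable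
  · exact hX.hasDeHaanRepresentation hp1 hp hU hW'
  · exact hX.exists_stableNoise hp1 hpq hq
  · exact hX.hasLpRepresentation_of_lt hp1 hpq hq hT hW'
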